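/- **Setting.** Let $\mathcal X=\prod_{i=1}^n[0,u_i]\subset\mathbb R^n$ with $u_i>0$, and let $\mathcal C\subseteq\mathcal X$ be compact and convex. Let $p(\cdot;x)$, $x\in\mathcal X$, be positive probability densities on a sample space with respect to a fixed $\sigma$-finite measure, let $\tilde F(x,z)$ be a real function on $\mathcal X\times\{z\}$, and suppose that $\tilde F(\cdot,z)$ and $\log p(z;\cdot)$ are $C^2$ on $\mathcal X$ for every $z$. (All gradients and Hessians are with respect to $x$, $\|\cdot\|$ is the Euclidean norm of vectors and the operator norm of matrices.) Put $F(x)=\mathbb E_{z\sim p(\cdot;x)}[\tilde F(x,z)]$, and assume that $F$ is monotone and DR-submodular on $\mathcal X$, that is, for the componentwise order, $x\le y$ implies $F(x)\le F(y)$ and $F(y+ke_i)-F(y)\le F(x+ke_i)-F(x)$ for every standard basis vector $e_i$ and every $k\ge 0$ for which $x+ke_i,\,y+ke_i\in\mathcal X$. Let $x^*\in\mathcal C$ be a maximizer of $F$ over $\mathcal C$ and $OPT=F(x^*)$. **Assumptions.** 1. $\|x-y\|\le D$ for all $x,y\in\mathcal C\cup\{0\}$. 2. $F(0)\ge 0$.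 3. $|\tilde F(x,z)|\le B$, $\|\nabla\tilde F(x,z)\|\le G$ and $\|\nabla^2\tilde F(x,z)\|\le L_{\tilde F}$ for all $x\in\mathcal X$ and all $z$. 4. $\mathbb E_{z\sim p(\cdot;x)}\|\nabla\log p(z;x)\|^4\le G_p^4$ and $\mathbb E_{z\sim p(\cdot;x)}\|\nabla^2\log p(z;x)\|^2\le L_p^2$ for all $x\in\mathcal X$, where $G_p,L_p\ge 0$. 5. $\|\nabla^2\tilde F(x,z)-\nabla^2\tilde F(y,z)\|\le L_{2,\tilde F}\|x-y\|$ and $\|\nabla^2\log p(z;x)-\nabla^2\log p(z;y)\|\le L_{2,p}\|x-y\|$ for all $x,y\in\mathcal X$ and all $z$. Let $L\ge BG_p^2+2GG_p+L_{\tilde F}+BL_p$. **Algorithm (SCG++).** Let $T\ge 1$ be the number of iterations, $m\ge T$ the batch size, and $m_0\ge 1$ an initial batch size with $m_0L^2D^2\ge T^2(G+BG_p)^2$. Put $x_0=0$. At iteration $t=0,\dots,T-1$: * If $t=0$, draw $z_1,\dots,z_{m_0}$ independently from $p(\cdot;0)$ and let $\hat g_0=\frac1{m_0}\sum_{i}\big(\nabla\tilde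 F+\tilde F\,\nabla\log p\big)(0,z_i)$. * If $t\ge1$, draw, given the past, $m$ independent pairs $(a,z(a))$, where $a$ is uniform on $[0,1]$ and $z(a)$ has, given $a$, the density $p(\cdot;x(a))$ with $x(a)=a x_t+(1-a)x_{t-1}$; let $\tilde\nabla^2_t$ be the average over these pairs of $$\big[\tilde F\,\nabla\log p\,(\nabla\log p)^{\top}+\nabla\tilde F(\nabla\log p)^{\top}+\nabla\log p\,(\nabla\tilde F)^{\top}+\nabla^2\tilde F+\tilde F\,\nabla^2\log p\big](x(a),z(a)),$$ and let $\hat g_t=\hat g_{t-1}+\tilde\nabla^2_t(x_t-x_{t-1})$. * Choose $v_t\in\arg\max_{v\in\mathcal C}\langle\hat g_t,v\rangle$ (ties broken in any way that depends measurably on the information available at iteration $t$) and put $x_{t+1}=x_t+\frac1Tv_t$. **Theorem.** For every $\delta>0$, with probability at least $1-\frac{T}{\delta^2}$, $$F(x_T)\ \ge\ \Big(1-\frac1e\Big)OPT-\delta\,\frac{LD^2}{T}-\frac{LD^2}{2T^2}.$$ In particular $F(x_T)\ge(1-\frac1e)OPT-O(\delta/T)$: with probability at least $1-\frac{T}{\delta^2}$,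 $$F(x_T)\ \ge\ \Big(1-\frac1e\Big)OPT-\frac32LD^2\cdot\frac{\delta}{T}.$$ -/

import Mathlib

open MeasureTheory ProbabilityTheory Set

noncomputable section

namespace SCGPlusPlus

/-- `ℝⁿ` with the Euclidean norm. -/
abbrev Vec (n : ℕ) : Type := EuclideanSpace ℝ (Fin n)

/-- The domain `X = ∏ᵢ [0, uᵢ]`. -/
def box {n : ℕ} (u : Fin n → ℝ) : Set (Vec n) := {x | ∀ i, 0 ≤ x i ∧ x i ≤ u i}

/-- The Hessian at `x` of a function on `X`, as the derivative of the gradient; its norm is the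
operator norm. -/
def hess {n : ℕ} (X : Set (Vec n)) (f : Vec n → ℝ) (x : Vec n) : Vec n →L[ℝ] Vec n :=
  fderivWithin ℝ (gradientWithin f X) X x

/-- The rank-one operator `a bᵀ : w ↦ ⟪b, w⟫ a`. -/
def outer {n : ℕ} (a b : Vec n) : Vec n →L[ℝ] Vec n := (innerSL ℝ b).smulRight a

/-- `F` is nondecreasing on `X` for the componentwise order. -/
def MonotoneObj {n : ℕ} (X : Set (Vec n)) (F : Vec n → ℝ) : Prop :=
  ∀ x ∈ X, ∀ y ∈ X, (∀ i, x i ≤ y i) → F x ≤ F y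

/-- `F` has the diminishing-returns property on `X`. -/
def DRSubmodular {n : ℕ} (X : Set (Vec n)) (F : Vec n → ℝ) : Prop :=
  ∀ x ∈ X, ∀ y ∈ X, (∀ i, x i ≤ y i) → ∀ (i : Fin n) (k : ℝ), 0 ≤ k →
    x + EuclideanSpace.single i k ∈ X → y + EuclideanSpace.single i k ∈ X →
      F (y + EuclideanSpace.single i k) - F y ≤ F (x + EuclideanSpace.single i k) - F x

section Sampling

variable {n : ℕ} {Z : Type*} [MeasurableSpace Z]

/-- The law of `z` at `x`: it has density `p(·; x)` with respect to `ν`. -/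
def law (ν : Measure Z) (p : Vec n → Z → ℝ) (x : Vec n) : Measure Z :=
  ν.withDensity fun z => ENNReal.ofReal (p x z)

/-- The objective `F(x) = 𝔼_{z ∼ p(·; x)} F̃(x, z)`. -/
def objective (ν : Measure Z) (p Ft : Vec n → Z → ℝ) (x : Vec n) : ℝ :=
  ∫ z, Ft x z ∂(law ν p x)

/-- The score `∇ log p(z; x)`, the gradient being taken in `x`. -/
def score (X : Set (Vec n)) (p : Vec n → Z → ℝ) (x : Vec n) (z : Z) : Vec n :=
  gradientWithin (fun y => Real.log (p y z)) X x

/-- The Hessian `∇² log p(z; x)` in `x`. -/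
def scoreHess (X : Set (Vec n)) (p : Vec n → Z → ℝ) (x : Vec n) (z : Z) : Vec n →L[ℝ] Vec n :=
  hess X (fun y => Real.log (p y z)) x

/-- The unbiased one-sample estimate `∇F̃ + F̃ ∇log p` of `∇F(x)`. When the law of `z` does not
depend on `x` it is `∇F̃(x, z)`. -/
def gradEst (X : Set (Vec n)) (p Ft : Vec n → Z → ℝ) (x : Vec n) (z : Z) : Vec n :=
  gradientWithin (fun y => Ft y z) X x + Ft x z • score X p x z

/-- The unbiased one-sample estimate of `∇²F(x)`:
`F̃ (∇log p)(∇log p)ᵀ + ∇F̃ (∇log p)ᵀ + (∇log p) ∇F̃ᵀ + ∇²F̃ + F̃ ∇²log p`. -/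
def hessEst (X : Set (Vec n)) (p Ft : Vec n → Z → ℝ) (x : Vec n) (z : Z) : Vec n →L[ℝ] Vec n :=
  Ft x z • outer (score X p x z) (score X p x z)
    + outer (gradientWithin (fun y => Ft y z) X x) (score X p x z)
    + outer (score X p x z) (gradientWithin (fun y => Ft y z) X x)
    + hess X (fun y => Ft y z) x
    + Ft x z • scoreHess X p x z

/-- The point `x(a) = a y + (1 - a) x` of the segment from the previous iterate `x` to the
current iterate `y`. -/
def segPoint (x y : Vec n) (a : ℝ) : Vec n := a • y + (1 - a) • x

/-- The joint law of one sample `(a, z(a))`: `a` is uniform on `[0, 1]` and, given `a`, `z(a)` has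
density `p(·; x(a))`. -/
def segLaw (ν : Measure Z) (p : Vec n → Z → ℝ) (x y : Vec n) : Measure (ℝ × Z) :=
  (((volume : Measure ℝ).restrict (Icc 0 1)).prod ν).withDensity
    fun q => ENNReal.ofReal (p (segPoint x y q.1) q.2)

/-- The model of the random samples: for every `x ∈ X`, `p(·; x)` is a positive probability
density and `F̃(x, ·)` is measurable; for every `z`, `F̃(·, z)` and `log p(z; ·)` are twice
continuously differentiable on `X`. -/
structure IsModel (X : Set (Vec n)) (ν : Measure Z) (p Ft : Vec n → Z → ℝ) : Prop where
  measurable_p : ∀ x ∈ X, Measurable (p x)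
  measurable_Ft : ∀ x ∈ X, Measurable (Ft x)
  p_pos : ∀ x ∈ X, ∀ z, 0 < p x z
  p_total : ∀ x ∈ X, ∫⁻ z, ENNReal.ofReal (p x z) ∂ν = 1
  contDiffOn_Ft : ∀ z, ContDiffOn ℝ 2 (fun x => Ft x z) X
  contDiffOn_log_p : ∀ z, ContDiffOn ℝ 2 (fun x => Real.log (p x z)) X

/-- A run of `T` iterations of SCG++ over `C`, with an initial batch of `m₀` samples and batches of
`m` samples at the later iterations, on a probability space `(Ω, P)`. Here `ℱ t` is the information
available after iteration `t` (so that `x (t + 1)` is known), `batch₀` is the initial batch,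
`batch t` is the batch used for the gradient estimate `g t` (for `1 ≤ t < T`), and `v t` is the
direction returned by the linear optimization over `C`; ties may be broken in any way. -/
structure IsRun {Ω : Type*} [MeasurableSpace Ω] (P : Measure Ω) (C X : Set (Vec n))
    (ν : Measure Z) (p Ft : Vec n → Z → ℝ) (T m₀ m : ℕ)
    (ℱ : Filtration ℕ ‹MeasurableSpace Ω›)
    (batch₀ : Ω → Fin m₀ → Z) (batch : ℕ → Ω → Fin m → ℝ × Z)
    (g v x : ℕ → Ω → Vec n) : Prop where
  /-- The iterates start at the origin. -/
  x_zero : ∀ ω, x 0 ω = 0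
  /-- The samples of the initial batch are independent draws from `p(·; 0)`. -/
  measurable_batch₀ : Measurable[ℱ 0] batch₀
  law_batch₀ : P.map batch₀ = Measure.pi fun _ => law ν p 0
  /-- The first gradient estimate is the average over the initial batch. -/
  g_zero : ∀ ω, g 0 ω = (m₀ : ℝ)⁻¹ • ∑ i, gradEst X p Ft 0 (batch₀ ω i)
  /-- Given the past, the samples of the next batch are `m` independent draws `(a, z(a))`. -/
  measurable_batch : ∀ t, t + 1 < T → Measurable[ℱ (t + 1)] (batch (t + 1))
  law_batch : ∀ t, t + 1 < T → ∀ A, MeasurableSet[ℱ t] A → ∀ S, MeasurableSet S →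
    P (A ∩ batch (t + 1) ⁻¹' S) =
      ∫⁻ ω in A, (Measure.pi fun _ : Fin m => segLaw ν p (x t ω) (x (t + 1) ω)) S ∂P
  /-- The gradient estimate is updated by the averaged Hessian estimate times the last step. -/
  g_succ : ∀ t, t + 1 < T → ∀ ω, g (t + 1) ω = g t ω +
    ((m : ℝ)⁻¹ • ∑ i, hessEst X p Ft
      (segPoint (x t ω) (x (t + 1) ω) (batch (t + 1) ω i).1) (batch (t + 1) ω i).2)
        (x (t + 1) ω - x t ω)
  /-- The direction maximizes `⟪g t, ·⟫` over `C`. -/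
  measurable_v : ∀ t, t < T → Measurable[ℱ t] (v t)
  v_mem : ∀ t, t < T → ∀ ω, v t ω ∈ C
  v_max : ∀ t, t < T → ∀ ω, ∀ w ∈ C, inner ℝ (g t ω) w ≤ inner ℝ (g t ω) (v t ω)
  /-- Frank-Wolfe step of size `1 / T`. -/
  x_succ : ∀ t, t < T → ∀ ω, x (t + 1) ω = x t ω + (1 / (T : ℝ)) • v t ω

end Sampling

end SCGPlusPlus

end

noncomputable section

namespace SCGPlusPlus

/-! ### Geometry of the box and projection onto it -/

section Box

variable {n : ℕ} {u : Fin n → ℝ}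

/-! The analysis is Frank–Wolfe with inexact gradients, together with control of the mean squared
error of the gradient estimates and Markov's inequality.

Differentiating `p * F̃` and then `p * gradEst` gives `p` times `gradEst` and `p` times `hessEst`.
Integrated along a segment and over the sample with Fubini, this yields two facts. The averaged
Hessian estimate applied to a step is unbiased for the increment of `gradMean`. And since
Minkowski's inequality bounds `hessEst` in L² by `L`, the map `gradMean` is `L`-Lipschitz, so that
the objective `F` satisfies a quadratic Taylor bound. No other regularity of `F` is used:
monotonicity and diminishing returns of finite differences, with this Taylor bound, give `F y - F x
≤ ⟪gradMean x, y⟫` on the box (`DRSubmodular.sub_le_inner_of_monotone`).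

Given the past, the error of the gradient estimate changes by a centred average of `m` independent
terms of second moment at most `(L D / T)²`. Cross terms vanish, so each step adds at most `(L D /
T)² / m ≤ (L D / T)² / T`. The initial batch is large enough to start at `(L D / T)²`, whence `E
‖ε_t‖² ≤ (L D / T)² (1 + t / T)` (`IsRun.lintegral_gradError_le`).

On each path, the gap `OPT - F(x_t)` contracts by `1 - 1/T` up to `D ‖ε_t‖ / T + L D² / (2 T²)`.
Unrolling gives a loss of `D` times the average of `‖ε_t‖`, plus `L D² / (2 T)`
(`IsRun.objective_ge`). To reach the claimed bound exactly, the average error must be at most `(L D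
/ T)(δ - a)` with `a = (1 - 1/T) / 2`. The mean of the average squared error is at most `(L D / T)²
(1 + a)`, so Markov's inequality leaves a failure probability `(1 + a) / (δ - a)²`. This is at most
`T / δ²` when `T ≤ δ²` (`one_add_mul_sq_le`); otherwise the probability bound is trivial. -/

lemma convex_box (u : Fin n → ℝ) : Convex ℝ (box u) := by
  intro x hx y hy a b ha hb hab i
  have h1 := hx i
  have h2 := hy i
  simp only [PiLp.add_apply, PiLp.smul_apply, smul_eq_mul]
  constructor
  · exact add_nonneg (mul_nonneg ha h1.1) (mul_nonneg hb h2.1)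
  · calc a * x i + b * y i ≤ a * u i + b * u i := by gcongr <;> tauto
      _ = u i := by rw [← add_mul, hab, one_mul]

lemma zero_mem_box (hu : ∀ i, 0 < u i) : (0 : Vec n) ∈ box u := fun i => ⟨le_rfl, (hu i).le⟩

/-- The box is convex with nonempty interior. Derivatives within it are therefore unique up to the
boundary, which matters already at the starting point `0`. -/
lemma uniqueDiffOn_box (hu : ∀ i, 0 < u i) : UniqueDiffOn ℝ (box u) := by
  refine uniqueDiffOn_convex (convex_box u) ⟨WithLp.toLp 2 fun i => u i / 2, ?_⟩
  have ho : IsOpen {x : Vec n | ∀ i, 0 < x i ∧ x i < u i} := by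
    rw [ofPred_forall]
    refine isOpen_iInter_of_finite fun i => ?_
    have hi : Continuous fun x : Vec n => x i := by fun_prop
    exact (isOpen_lt continuous_const hi).inter (isOpen_lt hi continuous_const)
  refine interior_maximal (fun x hx i => ⟨(hx i).1.le, (hx i).2.le⟩) ho ?_
  intro i
  have := hu i
  constructor <;> simp <;> linarith

/-- The coordinatewise projection onto the box. -/
def clamp (u : Fin n → ℝ) (x : Vec n) : Vec n := WithLp.toLp 2 fun i => max 0 (min (x i) (u i))

lemma continuous_clamp (u : Fin n → ℝ) : Continuous (clamp u) := by
  unfold clamp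
  fun_prop

lemma clamp_mem (hu : ∀ i, 0 < u i) (x : Vec n) : clamp u x ∈ box u := by
  intro i
  simp [clamp, (hu i).le]

lemma clamp_of_mem {x : Vec n} (hx : x ∈ box u) : clamp u x = x := by
  ext i
  simp [clamp, (hx i).1, (hx i).2]

lemma segPoint_mem {X : Set (Vec n)} (hX : Convex ℝ X) {x y : Vec n} (hx : x ∈ X) (hy : y ∈ X)
    {a : ℝ} (ha : a ∈ Icc (0 : ℝ) 1) : segPoint x y a ∈ X :=
  hX hy hx ha.1 (by linarith [ha.2]) (by ring)

lemma hasDerivAt_segPoint (x y : Vec n) (a : ℝ) : HasDerivAt (segPoint x y) (y - x) a := by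
  have := ((hasDerivAt_id a).smul_const y).add (((hasDerivAt_id a).const_sub 1).smul_const x)
  refine this.congr_deriv ?_
  simp [sub_eq_add_neg]

lemma segPoint_sub (x y : Vec n) (a : ℝ) : segPoint x y a - x = a • (y - x) := by
  simp only [segPoint]; module

/-- Differences of points of the box along a coordinate span the coordinate axis. -/
lemma exists_sub_eq_single (hu : ∀ i, 0 < u i) (i : Fin n) :
    ∃ w₁ ∈ box u, ∃ w₂ ∈ box u, EuclideanSpace.single i (1 : ℝ) = (u i)⁻¹ • (w₁ - w₂) := by
  refine ⟨EuclideanSpace.single i (u i), fun j => ?_, 0, zero_mem_box hu, ?_⟩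
  · by_cases h : j = i
    · subst h; simp [(hu j).le]
    · simp [h, (hu j).le]
  · ext j
    by_cases h : j = i
    · subst h; simp [(hu j).ne']
    · simp [h]

end Box

/-! ### Measurability in the sample, and jointly in the parameter -/

section Measurability

variable {n : ℕ} {u : Fin n → ℝ} {Z : Type*} [MeasurableSpace Z]

/-- A function that is continuous in the parameter and measurable in the sample is jointly
measurable, once the parameter is projected onto the box. -/
lemma measurable_clamp_uncurry {E : Type*} [NormedAddCommGroup E] [MeasurableSpace E]
    [BorelSpace E] (hu : ∀ i, 0 < u i) {f : Vec n → Z → E}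
    (hc : ∀ z, ContinuousOn (fun x => f x z) (box u)) (hm : ∀ x ∈ box u, Measurable (f x)) :
    Measurable fun q : Vec n × Z => f (clamp u q.1) q.2 := by
  refine measurable_uncurry_of_continuous_of_measurable (u := fun x z => f (clamp u x) z) ?_ ?_
  · intro z
    exact (hc z).comp_continuous (continuous_clamp u) (clamp_mem hu)
  · intro x
    exact hm _ (clamp_mem hu x)

/-- By convexity the difference quotients towards `w` stay inside `X`. The derivative in direction
`w - x` is thus a limit of a sequence of functions known to be measurable in the sample. -/
lemma tendsto_slope_of_hasFDerivWithinAt {E : Type*} [NormedAddCommGroup E] [NormedSpace ℝ E]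
    {X : Set (Vec n)} (hX : Convex ℝ X) {f : Vec n → E}
    {f' : Vec n →L[ℝ] E} {x w : Vec n} (hx : x ∈ X) (hw : w ∈ X) (h : HasFDerivWithinAt f f' X x) :
    Filter.Tendsto (fun k : ℕ => (k + 1 : ℝ) • (f (x + (1 / (k + 1 : ℝ)) • (w - x)) - f x))
      Filter.atTop (nhds (f' (w - x))) := by
  have hk : Filter.Tendsto (fun k : ℕ => (1 / (k + 1 : ℝ)) • (w - x)) Filter.atTop (nhds 0) := by
    simpa using (tendsto_one_div_add_atTop_nhds_zero_nat (𝕜 := ℝ)).smul_const (w - x)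
  refine h.lim hk (Filter.Eventually.of_forall fun k => ?_) ?_
  · refine hX.add_smul_sub_mem hx hw ⟨by positivity, ?_⟩
    rw [div_le_one (by positivity)]
    linarith [(Nat.cast_nonneg k : (0 : ℝ) ≤ k)]
  · refine tendsto_const_nhds.congr fun k => ?_
    have : (k + 1 : ℝ) ≠ 0 := by positivity
    rw [smul_smul, mul_one_div_cancel this, one_smul]

/-- The derivative in the parameter is measurable in the sample. -/
lemma measurable_of_hasFDerivWithinAt {E : Type*} [NormedAddCommGroup E] [NormedSpace ℝ E]
    [MeasurableSpace E] [BorelSpace E] [SecondCountableTopology E] (hu : ∀ i, 0 < u i) {f : Vec n → Z → E}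
    {f' : Vec n → Z → Vec n →L[ℝ] E} (hm : ∀ x ∈ box u, Measurable (f x)) {x : Vec n}
    (hx : x ∈ box u) (h : ∀ z, HasFDerivWithinAt (fun y => f y z) (f' x z) (box u) x) :
    Measurable (f' x) := by
  have hw : ∀ w ∈ box u, Measurable fun z => f' x z (w - x) := by
    intro w hw
    refine measurable_of_tendsto_metrizable (fun k => ?_)
      (tendsto_pi_nhds.2 fun z => tendsto_slope_of_hasFDerivWithinAt (convex_box u) hx hw (h z))
    refine Measurable.const_smul (Measurable.sub (hm _ ?_) (hm x hx)) _
    refine (convex_box u).add_smul_sub_mem hx hw ⟨by positivity, ?_⟩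
    rw [div_le_one (by positivity)]
    linarith [(Nat.cast_nonneg k : (0 : ℝ) ≤ k)]
  -- Only directions `w - x` with `w` in the box are available so far. Their differences include
  -- multiples of every basis vector, because `x` cancels.
  have hi : ∀ i, Measurable fun z => f' x z (EuclideanSpace.single i 1) := by
    intro i
    obtain ⟨w₁, h₁, w₂, h₂, he⟩ := exists_sub_eq_single hu i
    have : (fun z => f' x z (EuclideanSpace.single i 1))
        = fun z => (u i)⁻¹ • (f' x z (w₁ - x) - f' x z (w₂ - x)) := by
      funext z
      rw [he, ← map_sub, ← map_smul]; congr 2; abel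
    rw [this]
    exact ((hw w₁ h₁).sub (hw w₂ h₂)).const_smul _
  have hrep : f' x = fun z => ∑ i, (ContinuousLinearMap.smulRightL ℝ (Vec n) E
      (EuclideanSpace.proj i)) (f' x z (EuclideanSpace.single i 1)) := by
    funext z
    ext v
    conv_lhs => rw [← (EuclideanSpace.basisFun (Fin n) ℝ).sum_repr v]
    simp
  rw [hrep]
  exact Finset.measurable_sum _ fun i _ => (ContinuousLinearMap.continuous _).measurable.comp (hi i)

end Measurability

/-! ### Gradients, Hessians and rank-one operators within a set -/

section Calculus

variable {n : ℕ} {X : Set (Vec n)} {f : Vec n → ℝ}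

lemma hasFDerivWithinAt_of_contDiffOn (hf : ContDiffOn ℝ 2 f X) {x : Vec n} (hx : x ∈ X) :
    HasFDerivWithinAt f (innerSL ℝ (gradientWithin f X x)) X x :=
  (hf.differentiableOn (by norm_num) x hx).hasGradientWithinAt.hasFDerivWithinAt

lemma contDiffOn_gradientWithin (hX : UniqueDiffOn ℝ X) (hf : ContDiffOn ℝ 2 f X) :
    ContDiffOn ℝ 1 (gradientWithin f X) X :=
  (InnerProductSpace.toDual ℝ (Vec n)).symm.contDiff.comp_contDiffOn
    (hf.fderivWithin hX (by norm_num))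

lemma hasFDerivWithinAt_gradientWithin (hX : UniqueDiffOn ℝ X) (hf : ContDiffOn ℝ 2 f X)
    {x : Vec n} (hx : x ∈ X) : HasFDerivWithinAt (gradientWithin f X) (hess X f x) X x :=
  ((contDiffOn_gradientWithin hX hf).differentiableOn (by norm_num) x hx).hasFDerivWithinAt

lemma continuousOn_hess (hX : UniqueDiffOn ℝ X) (hf : ContDiffOn ℝ 2 f X) :
    ContinuousOn (hess X f) X :=
  (contDiffOn_gradientWithin hX hf).continuousOn_fderivWithin hX (by norm_num)

lemma continuous_outer : Continuous fun q : Vec n × Vec n => outer q.1 q.2 := by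
  unfold outer
  exact ((ContinuousLinearMap.smulRightL ℝ (Vec n) (Vec n)).continuous.comp
    ((innerSL ℝ).continuous.comp continuous_snd)).clm_apply continuous_fst

lemma measurable_outer {Z : Type*} [MeasurableSpace Z] {a b : Z → Vec n} (ha : Measurable a)
    (hb : Measurable b) : Measurable fun z => outer (a z) (b z) := by
  have h : Measurable fun q : Vec n × Vec n => outer q.1 q.2 := continuous_outer.measurable
  have h2 : Measurable fun z => (a z, b z) := ha.prodMk hb
  have h3 := Measurable.comp h h2
  exact h3

lemma continuousOn_outer {a b : Vec n → Vec n} (ha : ContinuousOn a X) (hb : ContinuousOn b X) :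
    ContinuousOn (fun x => outer (a x) (b x)) X := by
  have h2 : ContinuousOn (fun z => (a z, b z)) X := ha.prodMk hb
  have h3 := Continuous.comp_continuousOn continuous_outer h2
  exact h3

lemma outer_apply (a b w : Vec n) : outer a b w = inner ℝ b w • a := rfl

lemma norm_outer (a b : Vec n) : ‖outer a b‖ = ‖b‖ * ‖a‖ := by
  simp [outer, ContinuousLinearMap.norm_smulRight_apply]

end Calculus

/-! ### Regularity of the estimators and the log-derivative trick -/

section Model

variable {n : ℕ} {u : Fin n → ℝ} {Z : Type*} [MeasurableSpace Z] {ν : Measure Z}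
  {p Ft : Vec n → Z → ℝ}

lemma IsModel.measurable_log_p (h : IsModel (box u) ν p Ft) {x : Vec n} (hx : x ∈ box u) :
    Measurable fun z => Real.log (p x z) := (h.measurable_p x hx).log

lemma measurable_gradientWithin (hu : ∀ i, 0 < u i) {f : Vec n → Z → ℝ}
    (hm : ∀ x ∈ box u, Measurable (f x)) (hf : ∀ z, ContDiffOn ℝ 2 (fun x => f x z) (box u))
    {x : Vec n} (hx : x ∈ box u) :
    Measurable fun z => gradientWithin (fun y => f y z) (box u) x := by
  have h := measurable_of_hasFDerivWithinAt hu hm hx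
    (f' := fun x z => innerSL ℝ (gradientWithin (fun y => f y z) (box u) x))
    fun z => hasFDerivWithinAt_of_contDiffOn (hf z) hx
  have h2 := (InnerProductSpace.toDual ℝ (Vec n)).symm.continuous.measurable.comp h
  refine (congrArg Measurable ?_).mp h2
  funext z
  exact (InnerProductSpace.toDual ℝ (Vec n)).symm_apply_apply _

lemma measurable_hess (hu : ∀ i, 0 < u i) {f : Vec n → Z → ℝ}
    (hm : ∀ x ∈ box u, Measurable (f x)) (hf : ∀ z, ContDiffOn ℝ 2 (fun x => f x z) (box u))
    {x : Vec n} (hx : x ∈ box u) :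
    Measurable fun z => hess (box u) (fun y => f y z) x :=
  measurable_of_hasFDerivWithinAt hu
    (f := fun x z => gradientWithin (fun y => f y z) (box u) x)
    (f' := fun x z => hess (box u) (fun y => f y z) x)
    (fun _ hy => measurable_gradientWithin hu hm hf hy) hx
    fun z => hasFDerivWithinAt_gradientWithin (uniqueDiffOn_box hu) (hf z) hx

lemma IsModel.measurable_grad (h : IsModel (box u) ν p Ft) (hu : ∀ i, 0 < u i) {x : Vec n}
    (hx : x ∈ box u) : Measurable fun z => gradientWithin (fun y => Ft y z) (box u) x :=
  measurable_gradientWithin hu h.measurable_Ft h.contDiffOn_Ft hx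

lemma IsModel.measurable_score (h : IsModel (box u) ν p Ft) (hu : ∀ i, 0 < u i) {x : Vec n}
    (hx : x ∈ box u) : Measurable (score (box u) p x) :=
  measurable_gradientWithin (f := fun x z => Real.log (p x z)) hu (fun _ => h.measurable_log_p)
    h.contDiffOn_log_p hx

lemma IsModel.measurable_scoreHess (h : IsModel (box u) ν p Ft) (hu : ∀ i, 0 < u i) {x : Vec n}
    (hx : x ∈ box u) : Measurable (scoreHess (box u) p x) :=
  measurable_hess (f := fun x z => Real.log (p x z)) hu (fun _ => h.measurable_log_p)
    h.contDiffOn_log_p hx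

lemma IsModel.measurable_gradEst (h : IsModel (box u) ν p Ft) (hu : ∀ i, 0 < u i) {x : Vec n}
    (hx : x ∈ box u) : Measurable (gradEst (box u) p Ft x) :=
  (h.measurable_grad hu hx).add ((h.measurable_Ft x hx).smul (h.measurable_score hu hx))

lemma IsModel.measurable_hessEst (h : IsModel (box u) ν p Ft) (hu : ∀ i, 0 < u i) {x : Vec n}
    (hx : x ∈ box u) : Measurable (hessEst (box u) p Ft x) := by
  have hs := h.measurable_score hu hx
  have hg := h.measurable_grad hu hx
  have hf := h.measurable_Ft x hx
  have h1 : Measurable fun z => Ft x z • outer (score (box u) p x z) (score (box u) p x z) :=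
    hf.smul (measurable_outer hs hs)
  have h2 := measurable_outer hg hs
  have h3 := measurable_outer hs hg
  have h4 : Measurable fun z => hess (box u) (fun y => Ft y z) x :=
    measurable_hess hu h.measurable_Ft h.contDiffOn_Ft hx
  have h5 : Measurable fun z => Ft x z • scoreHess (box u) p x z :=
    hf.smul (h.measurable_scoreHess hu hx)
  unfold hessEst
  exact (((h1.add h2).add h3).add h4).add h5

lemma IsModel.continuousOn_score (h : IsModel (box u) ν p Ft) (hu : ∀ i, 0 < u i) (z : Z) :
    ContinuousOn (fun x => score (box u) p x z) (box u) :=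
  (contDiffOn_gradientWithin (uniqueDiffOn_box hu) (h.contDiffOn_log_p z)).continuousOn

lemma IsModel.continuousOn_gradEst (h : IsModel (box u) ν p Ft) (hu : ∀ i, 0 < u i) (z : Z) :
    ContinuousOn (fun x => gradEst (box u) p Ft x z) (box u) :=
  (contDiffOn_gradientWithin (uniqueDiffOn_box hu) (h.contDiffOn_Ft z)).continuousOn.add
    ((h.contDiffOn_Ft z).continuousOn.smul (h.continuousOn_score hu z))

lemma IsModel.continuousOn_hessEst (h : IsModel (box u) ν p Ft) (hu : ∀ i, 0 < u i) (z : Z) :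
    ContinuousOn (fun x => hessEst (box u) p Ft x z) (box u) := by
  have hs := h.continuousOn_score hu z
  have hg := (contDiffOn_gradientWithin (uniqueDiffOn_box hu) (h.contDiffOn_Ft z)).continuousOn
  have hf := (h.contDiffOn_Ft z).continuousOn
  have h1 : ContinuousOn (fun x => Ft x z • outer (score (box u) p x z) (score (box u) p x z))
      (box u) := hf.smul (continuousOn_outer hs hs)
  have h2 := continuousOn_outer hg hs
  have h3 := continuousOn_outer hs hg
  have h4 := continuousOn_hess (uniqueDiffOn_box hu) (h.contDiffOn_Ft z)
  have h5 : ContinuousOn (fun x => Ft x z • scoreHess (box u) p x z) (box u) :=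
    hf.smul (continuousOn_hess (uniqueDiffOn_box hu) (h.contDiffOn_log_p z))
  unfold hessEst
  exact (((h1.add h2).add h3).add h4).add h5

/-- Chain rule for `p = exp (log p)`, valid on the box because `p` is positive there. -/
lemma IsModel.hasFDerivWithinAt_p (h : IsModel (box u) ν p Ft) (z : Z) {x : Vec n}
    (hx : x ∈ box u) :
    HasFDerivWithinAt (fun y => p y z) (p x z • innerSL ℝ (score (box u) p x z)) (box u) x := by
  have h1 := (hasFDerivWithinAt_of_contDiffOn (h.contDiffOn_log_p z) hx).exp
  rw [Real.exp_log (h.p_pos x hx z)] at h1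
  exact h1.congr (fun y hy => (Real.exp_log (h.p_pos y hy z)).symm)
    (Real.exp_log (h.p_pos x hx z)).symm

lemma IsModel.continuousOn_p (h : IsModel (box u) ν p Ft) (z : Z) :
    ContinuousOn (fun x => p x z) (box u) :=
  fun _ hx => (h.hasFDerivWithinAt_p z hx).continuousWithinAt

/-- The log-derivative trick: `∇(p F̃) = p (∇F̃ + F̃ ∇log p)`. -/
lemma IsModel.hasFDerivWithinAt_p_mul_Ft (h : IsModel (box u) ν p Ft) (z : Z) {x : Vec n}
    (hx : x ∈ box u) :
    HasFDerivWithinAt (fun y => p y z • Ft y z)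
      (p x z • innerSL ℝ (gradEst (box u) p Ft x z)) (box u) x := by
  refine ((h.hasFDerivWithinAt_p z hx).smul
    (hasFDerivWithinAt_of_contDiffOn (h.contDiffOn_Ft z) hx)).congr_fderiv ?_
  ext w
  simp only [add_apply, smul_apply, ContinuousLinearMap.smulRight_apply, innerSL_apply_apply,
    gradEst, inner_add_left, inner_smul_left, smul_eq_mul, score, conj_trivial]
  ring

/-- The log-derivative trick at second order: the derivative of `p (∇F̃ + F̃ ∇log p)` is `p` times
the Hessian estimate. -/
lemma IsModel.hasFDerivWithinAt_p_smul_gradEst (h : IsModel (box u) ν p Ft) (hu : ∀ i, 0 < u i)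
    (z : Z) {x : Vec n} (hx : x ∈ box u) :
    HasFDerivWithinAt (fun y => p y z • gradEst (box u) p Ft y z)
      (p x z • hessEst (box u) p Ft x z) (box u) x := by
  have h1 := hasFDerivWithinAt_gradientWithin (uniqueDiffOn_box hu) (h.contDiffOn_Ft z) hx
  have h2 := hasFDerivWithinAt_gradientWithin (uniqueDiffOn_box hu) (h.contDiffOn_log_p z) hx
  have h3 := hasFDerivWithinAt_of_contDiffOn (h.contDiffOn_Ft z) hx
  have h4 : HasFDerivWithinAt (fun y => gradEst (box u) p Ft y z)
      (hess (box u) (fun y => Ft y z) x + (Ft x z • scoreHess (box u) p x z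
        + outer (score (box u) p x z) (gradientWithin (fun y => Ft y z) (box u) x))) (box u) x :=
    h1.add (h3.smul h2)
  refine ((h.hasFDerivWithinAt_p z hx).smul h4).congr_fderiv ?_
  ext1 w
  simp only [add_apply, smul_apply, ContinuousLinearMap.smulRight_apply, innerSL_apply_apply,
    hessEst, outer_apply, gradEst, smul_eq_mul]
  module

end Model

/-! ### Parameter integrals along a segment -/

section LineIntegral

variable {n : ℕ} {u : Fin n → ℝ} {Z : Type*} [MeasurableSpace Z] {ν : Measure Z} [SigmaFinite ν]

instance : IsProbabilityMeasure ((volume : Measure ℝ).restrict (Icc 0 1)) :=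
  ⟨by simp⟩

lemma continuous_segPoint_uncurry :
    Continuous fun q : (Vec n × Vec n) × ℝ => segPoint q.1.1 q.1.2 q.2 := by
  unfold segPoint
  fun_prop

lemma continuous_segPoint (x y : Vec n) : Continuous (segPoint x y) :=
  continuous_iff_continuousAt.2 fun a => (hasDerivAt_segPoint x y a).continuousAt

lemma ae_prod_fst_mem_Icc (ν : Measure Z) [SFinite ν] :
    ∀ᵐ q ∂(((volume : Measure ℝ).restrict (Icc 0 1)).prod ν), q.1 ∈ Icc (0 : ℝ) 1 :=
  Measure.quasiMeasurePreserving_fst.ae (ae_restrict_mem measurableSet_Icc)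

lemma continuousOn_comp_segPoint {X : Set (Vec n)} (hX : Convex ℝ X) {F : Type*}
    [TopologicalSpace F] {f : Vec n → F} (hf : ContinuousOn f X) {x y : Vec n} (hx : x ∈ X)
    (hy : y ∈ X) : ContinuousOn (fun a => f (segPoint x y a)) (Icc 0 1) :=
  hf.comp (continuous_segPoint x y).continuousOn fun _ ha => segPoint_mem hX hx hy ha

/-- A function along a segment of the box, continuous in the parameter and measurable in the
sample, is a.e. strongly measurable in the position and the sample. -/
lemma aestronglyMeasurable_segPoint {E : Type*} [NormedAddCommGroup E] [MeasurableSpace E]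
    [BorelSpace E] [SecondCountableTopology E] (hu : ∀ i, 0 < u i) {f : Vec n → Z → E}
    (hc : ∀ z, ContinuousOn (fun x => f x z) (box u)) (hm : ∀ x ∈ box u, Measurable (f x))
    {x y : Vec n} (hx : x ∈ box u) (hy : y ∈ box u) :
    AEStronglyMeasurable (fun q : ℝ × Z => f (segPoint x y q.1) q.2)
      (((volume : Measure ℝ).restrict (Icc 0 1)).prod ν) := by
  have hseg : Measurable fun q : ℝ × Z => (segPoint x y q.1, q.2) :=
    ((continuous_segPoint x y).measurable.comp measurable_fst).prodMk measurable_snd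
  have h1 := (measurable_clamp_uncurry hu hc hm).comp hseg
  refine h1.aestronglyMeasurable.congr ?_
  filter_upwards [ae_prod_fst_mem_Icc ν] with q hq
  simp only [Function.comp_def]
  rw [clamp_of_mem (segPoint_mem (convex_box u) hx hy hq)]

/-- The fundamental theorem of calculus along a segment. -/
lemma integral_Icc_segPoint_eq_sub {E : Type*} [NormedAddCommGroup E] [NormedSpace ℝ E]
    [CompleteSpace E] {X : Set (Vec n)} (hX : Convex ℝ X) {f : Vec n → E}
    {f' : Vec n → Vec n →L[ℝ] E} (hd : ∀ x ∈ X, HasFDerivWithinAt f (f' x) X x)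
    (hc : ContinuousOn f' X) {x y : Vec n} (hx : x ∈ X) (hy : y ∈ X) :
    ∫ a in Icc (0 : ℝ) 1, f' (segPoint x y a) (y - x) = f y - f x := by
  rw [integral_Icc_eq_integral_Ioc, ← intervalIntegral.integral_of_le zero_le_one]
  have hcont : ContinuousOn (fun a => f' (segPoint x y a) (y - x)) (Icc 0 1) :=
    (continuousOn_comp_segPoint hX hc hx hy).clm_apply continuousOn_const
  have := intervalIntegral.integral_eq_sub_of_hasDerivAt_of_le (a := (0 : ℝ)) (b := 1)
    (f := fun a => f (segPoint x y a)) (f' := fun a => f' (segPoint x y a) (y - x)) zero_le_one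
    (continuousOn_comp_segPoint hX (fun z hz => (hd z hz).continuousWithinAt) hx hy) ?_
    (hcont.intervalIntegrable_of_Icc zero_le_one)
  · rw [this]; simp [segPoint]
  · intro a ha
    have hs : HasDerivWithinAt (segPoint x y) (y - x) (Icc 0 1) a :=
      (hasDerivAt_segPoint x y a).hasDerivWithinAt
    have hmaps : MapsTo (segPoint x y) (Icc 0 1) X := fun _ hb => segPoint_mem hX hx hy hb
    have h1 := (hd _ (hmaps (Ioo_subset_Icc_self ha))).comp_hasDerivWithinAt a hs hmaps
    have h2 := h1.hasDerivAt (Icc_mem_nhds ha.1 ha.2)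
    exact h2

variable {E : Type*} [NormedAddCommGroup E] [NormedSpace ℝ E] [MeasurableSpace E]
  [BorelSpace E] [SecondCountableTopology E] {φ : Vec n → Z → E} {φ' : Vec n → Z → Vec n →L[ℝ] E}

/-- Integrability on the product of the segment and the sample space, which licenses Fubini. The
`L¹` bound holds at each point of the segment, uniformly in its position, so Tonelli suffices. -/
lemma integrable_segPoint_of_lintegral_le (hu : ∀ i, 0 < u i)
    (hm : ∀ x ∈ box u, Measurable (φ x))
    (hd : ∀ z, ∀ x ∈ box u, HasFDerivWithinAt (fun y => φ y z) (φ' x z) (box u) x)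
    (hc : ∀ z, ContinuousOn (fun x => φ' x z) (box u)) {K : ℝ}
    (hK : ∀ x ∈ box u, ∫⁻ z, ‖φ' x z‖ₑ ∂ν ≤ ENNReal.ofReal K)
    {x y : Vec n} (hx : x ∈ box u) (hy : y ∈ box u) :
    Integrable (fun q : ℝ × Z => φ' (segPoint x y q.1) q.2 (y - x))
      (((volume : Measure ℝ).restrict (Icc 0 1)).prod ν) := by
  have hm' : ∀ x ∈ box u, Measurable (φ' x) := fun x hx =>
    measurable_of_hasFDerivWithinAt hu hm hx fun z => hd z x hx
  have hms := aestronglyMeasurable_segPoint (ν := ν) hu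
    (f := fun w z => φ' w z (y - x)) (fun z => (hc z).clm_apply continuousOn_const)
    (fun w hw => (hm' w hw).apply_continuousLinearMap (y - x)) hx hy
  refine ⟨hms, ?_⟩
  rw [HasFiniteIntegral, lintegral_prod _ hms.enorm]
  calc ∫⁻ a in Icc (0 : ℝ) 1, ∫⁻ z, ‖φ' (segPoint x y a) z (y - x)‖ₑ ∂ν
      ≤ ∫⁻ _ in Icc (0 : ℝ) 1, ENNReal.ofReal K * ‖y - x‖ₑ := by
        refine setLIntegral_mono' measurableSet_Icc fun a ha => ?_
        have hw := segPoint_mem (convex_box u) hx hy ha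
        calc ∫⁻ z, ‖φ' (segPoint x y a) z (y - x)‖ₑ ∂ν
            ≤ ∫⁻ z, ‖φ' (segPoint x y a) z‖ₑ * ‖y - x‖ₑ ∂ν :=
              lintegral_mono fun z => ContinuousLinearMap.le_opENorm _ _
          _ = (∫⁻ z, ‖φ' (segPoint x y a) z‖ₑ ∂ν) * ‖y - x‖ₑ :=
              lintegral_mul_const _ (hm' _ hw).enorm
          _ ≤ _ := by gcongr; exact hK _ hw
    _ < ⊤ := by
        simp only [lintegral_const, measure_univ, mul_one]
        exact ENNReal.mul_lt_top ENNReal.ofReal_lt_top enorm_lt_top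

variable [CompleteSpace E]

/-- Differentiation under the integral sign, in integrated form along a segment of the box. -/
lemma integral_sub_integral_eq (hu : ∀ i, 0 < u i)
    (hm : ∀ x ∈ box u, Measurable (φ x))
    (hd : ∀ z, ∀ x ∈ box u, HasFDerivWithinAt (fun y => φ y z) (φ' x z) (box u) x)
    (hc : ∀ z, ContinuousOn (fun x => φ' x z) (box u))
    (hint : ∀ x ∈ box u, Integrable (φ x) ν) {K : ℝ}
    (hK : ∀ x ∈ box u, ∫⁻ z, ‖φ' x z‖ₑ ∂ν ≤ ENNReal.ofReal K)
    {x y : Vec n} (hx : x ∈ box u) (hy : y ∈ box u) :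
    ∫ z, φ y z ∂ν - ∫ z, φ x z ∂ν =
      ∫ q, φ' (segPoint x y q.1) q.2 (y - x) ∂(((volume : Measure ℝ).restrict (Icc 0 1)).prod ν) := by
  -- With the position integrated first, the inner integral for each fixed `z` is the fundamental
  -- theorem of calculus; no domination of the derivative by a single function of `z` is needed.
  rw [integral_prod_symm _ (integrable_segPoint_of_lintegral_le hu hm hd hc hK hx hy),
    ← integral_sub (hint y hy) (hint x hx)]
  refine integral_congr_ae (Filter.Eventually.of_forall fun z => ?_)
  exact (integral_Icc_segPoint_eq_sub (convex_box u) (hd z) (hc z) hx hy).symm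

/-- The mean value inequality for an integral with a parameter. -/
lemma norm_integral_sub_integral_le (hu : ∀ i, 0 < u i)
    (hm : ∀ x ∈ box u, Measurable (φ x))
    (hd : ∀ z, ∀ x ∈ box u, HasFDerivWithinAt (fun y => φ y z) (φ' x z) (box u) x)
    (hc : ∀ z, ContinuousOn (fun x => φ' x z) (box u))
    (hint : ∀ x ∈ box u, Integrable (φ x) ν) {K : ℝ} (hK0 : 0 ≤ K)
    (hK : ∀ x ∈ box u, ∫⁻ z, ‖φ' x z‖ₑ ∂ν ≤ ENNReal.ofReal K)
    {x y : Vec n} (hx : x ∈ box u) (hy : y ∈ box u) :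
    ‖∫ z, φ y z ∂ν - ∫ z, φ x z ∂ν‖ ≤ K * ‖y - x‖ := by
  have hI := integrable_segPoint_of_lintegral_le hu hm hd hc hK hx hy
  rw [integral_sub_integral_eq hu hm hd hc hint hK hx hy, integral_prod _ hI]
  have : ∀ a ∈ Icc (0 : ℝ) 1,
      ‖∫ z, φ' (segPoint x y a) z (y - x) ∂ν‖ ≤ K * ‖y - x‖ := by
    intro a ha
    have hw := segPoint_mem (convex_box u) hx hy ha
    have hm' := measurable_of_hasFDerivWithinAt hu hm hw fun z => hd z _ hw
    have h1 : ∫⁻ z, ‖φ' (segPoint x y a) z (y - x)‖ₑ ∂ν ≤ ENNReal.ofReal (K * ‖y - x‖) :=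
      calc ∫⁻ z, ‖φ' (segPoint x y a) z (y - x)‖ₑ ∂ν
            ≤ ∫⁻ z, ‖φ' (segPoint x y a) z‖ₑ * ‖y - x‖ₑ ∂ν :=
              lintegral_mono fun z => ContinuousLinearMap.le_opENorm _ _
          _ = (∫⁻ z, ‖φ' (segPoint x y a) z‖ₑ ∂ν) * ‖y - x‖ₑ :=
              lintegral_mul_const _ hm'.enorm
          _ ≤ ENNReal.ofReal K * ‖y - x‖ₑ := by gcongr; exact hK _ hw
          _ = _ := by rw [ENNReal.ofReal_mul hK0, ofReal_norm]
    have h2 := (enorm_integral_le_lintegral_enorm _).trans h1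
    rwa [← ofReal_norm, ENNReal.ofReal_le_ofReal_iff (by positivity)] at h2
  have h3 := norm_setIntegral_le_of_norm_le_const (μ := volume) (s := Icc (0 : ℝ) 1)
    (by simp) this
  simpa using h3

end LineIntegral

/-- Translates moment bounds into `Lᵏ` norms, for which Minkowski's inequality and monotonicity in
the exponent are available. -/
lemma eLpNorm_le_ofReal_iff {α E : Type*} [MeasurableSpace α] [NormedAddCommGroup E]
    {μ : Measure α} {f : α → E} {k : ℕ} (hk : k ≠ 0) {c : ℝ} (hc : 0 ≤ c) :
    eLpNorm f k μ ≤ ENNReal.ofReal c ↔ ∫⁻ x, ‖f x‖ₑ ^ k ∂μ ≤ ENNReal.ofReal (c ^ k) := by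
  have h := eLpNorm_nnreal_pow_eq_lintegral (μ := μ) (f := f) (p := (k : NNReal))
    (by exact_mod_cast hk)
  simp only [NNReal.coe_natCast, ENNReal.rpow_natCast, ENNReal.coe_natCast] at h
  rw [← h, ENNReal.ofReal_pow hc, ENNReal.pow_le_pow_left_iff hk]

/-! ### L² bounds for the gradient and Hessian estimators -/

section Moments

variable {n : ℕ} {u : Fin n → ℝ} {Z : Type*} [MeasurableSpace Z] {ν : Measure Z}
  {p Ft : Vec n → Z → ℝ} {B G LF Gp Lp : ℝ}

/-- The bounds on the stochastic function and its derivatives, and on the moments of the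
derivatives of the log-density. -/
structure MomentBounds (X : Set (Vec n)) (ν : Measure Z) (p Ft : Vec n → Z → ℝ)
    (B G LF Gp Lp : ℝ) : Prop where
  abs_Ft_le : ∀ x ∈ X, ∀ z, |Ft x z| ≤ B
  norm_grad_le : ∀ x ∈ X, ∀ z, ‖gradientWithin (fun y => Ft y z) X x‖ ≤ G
  norm_hess_le : ∀ x ∈ X, ∀ z, ‖hess X (fun y => Ft y z) x‖ ≤ LF
  Gp_nonneg : 0 ≤ Gp
  Lp_nonneg : 0 ≤ Lp
  score_moment : ∀ x ∈ X, ∫⁻ z, ‖score X p x z‖ₑ ^ 4 ∂(law ν p x) ≤ ENNReal.ofReal (Gp ^ 4)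
  scoreHess_moment :
    ∀ x ∈ X, ∫⁻ z, ‖scoreHess X p x z‖ₑ ^ 2 ∂(law ν p x) ≤ ENNReal.ofReal (Lp ^ 2)

lemma IsModel.isProbabilityMeasure_law (h : IsModel (box u) ν p Ft) {x : Vec n}
    (hx : x ∈ box u) : IsProbabilityMeasure (law ν p x) :=
  ⟨by rw [law, withDensity_apply _ .univ, Measure.restrict_univ]; exact h.p_total x hx⟩

lemma IsModel.nonempty (h : IsModel (box u) ν p Ft) (hu : ∀ i, 0 < u i) : Nonempty Z := by
  have := h.isProbabilityMeasure_law (zero_mem_box hu)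
  exact (law ν p 0).nonempty_of_neZero

lemma IsModel.integral_law (h : IsModel (box u) ν p Ft) {E : Type*} [NormedAddCommGroup E]
    [NormedSpace ℝ E] {x : Vec n} (hx : x ∈ box u) (f : Z → E) :
    ∫ z, f z ∂(law ν p x) = ∫ z, p x z • f z ∂ν := by
  rw [law, integral_withDensity_eq_integral_toReal_smul (h.measurable_p x hx).ennreal_ofReal
    (Filter.Eventually.of_forall fun _ => ENNReal.ofReal_lt_top)]
  simp_rw [ENNReal.toReal_ofReal (h.p_pos x hx _).le]

lemma IsModel.integrable_law_iff (h : IsModel (box u) ν p Ft) {E : Type*} [NormedAddCommGroup E]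
    [NormedSpace ℝ E] {x : Vec n} (hx : x ∈ box u) {f : Z → E} :
    Integrable f (law ν p x) ↔ Integrable (fun z => p x z • f z) ν := by
  rw [law, integrable_withDensity_iff_integrable_smul' (h.measurable_p x hx).ennreal_ofReal
    (Filter.Eventually.of_forall fun _ => ENNReal.ofReal_lt_top)]
  simp_rw [ENNReal.toReal_ofReal (h.p_pos x hx _).le]

lemma IsModel.lintegral_enorm_p_smul (h : IsModel (box u) ν p Ft) {E : Type*}
    [NormedAddCommGroup E] [NormedSpace ℝ E] [MeasurableSpace E] [OpensMeasurableSpace E]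
    {x : Vec n} (hx : x ∈ box u) {f : Z → E} (hf : Measurable f) :
    ∫⁻ z, ‖p x z • f z‖ₑ ∂ν = eLpNorm f 1 (law ν p x) := by
  rw [eLpNorm_one_eq_lintegral_enorm, law,
    lintegral_withDensity_eq_lintegral_mul _ (h.measurable_p x hx).ennreal_ofReal hf.enorm]
  refine lintegral_congr fun z => ?_
  rw [enorm_smul, Real.enorm_eq_ofReal (h.p_pos x hx z).le, Pi.mul_apply]

lemma MomentBounds.B_nonneg (hb : MomentBounds (box u) ν p Ft B G LF Gp Lp)
    (h : IsModel (box u) ν p Ft) (hu : ∀ i, 0 < u i) : 0 ≤ B :=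
  let ⟨z⟩ := h.nonempty hu
  (abs_nonneg _).trans (hb.abs_Ft_le 0 (zero_mem_box hu) z)

lemma MomentBounds.G_nonneg (hb : MomentBounds (box u) ν p Ft B G LF Gp Lp)
    (h : IsModel (box u) ν p Ft) (hu : ∀ i, 0 < u i) : 0 ≤ G :=
  let ⟨z⟩ := h.nonempty hu
  (norm_nonneg _).trans (hb.norm_grad_le 0 (zero_mem_box hu) z)

lemma MomentBounds.LF_nonneg (hb : MomentBounds (box u) ν p Ft B G LF Gp Lp)
    (h : IsModel (box u) ν p Ft) (hu : ∀ i, 0 < u i) : 0 ≤ LF :=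
  let ⟨z⟩ := h.nonempty hu
  (norm_nonneg _).trans (hb.norm_hess_le 0 (zero_mem_box hu) z)

/-- Under a probability measure the `L²` norm is at most the `L⁴` norm. -/
lemma MomentBounds.eLpNorm_score_le (hb : MomentBounds (box u) ν p Ft B G LF Gp Lp)
    (h : IsModel (box u) ν p Ft) (hu : ∀ i, 0 < u i) {x : Vec n} (hx : x ∈ box u) :
    eLpNorm (score (box u) p x) 2 (law ν p x) ≤ ENNReal.ofReal Gp := by
  have := h.isProbabilityMeasure_law hx
  have h4 := (eLpNorm_le_ofReal_iff (by norm_num) hb.Gp_nonneg).2 (hb.score_moment x hx)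
  refine (eLpNorm_le_eLpNorm_of_exponent_le ?_
    (h.measurable_score hu hx).aestronglyMeasurable).trans h4
  norm_num

/-- The rank-one operator has norm `‖score‖²`, so its second moment is the fourth moment of the
score. This is where a fourth moment is really needed. -/
lemma MomentBounds.eLpNorm_outer_score_le (hb : MomentBounds (box u) ν p Ft B G LF Gp Lp)
    {x : Vec n} (hx : x ∈ box u) :
    eLpNorm (fun z => outer (score (box u) p x z) (score (box u) p x z)) 2 (law ν p x)
      ≤ ENNReal.ofReal (Gp ^ 2) := by
  refine (eLpNorm_le_ofReal_iff (k := 2) two_ne_zero (by positivity)).2 ?_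
  rw [← pow_mul]
  refine le_trans (le_of_eq (lintegral_congr fun z => ?_)) (hb.score_moment x hx)
  rw [← ofReal_norm, norm_outer, ENNReal.ofReal_mul (norm_nonneg _), ofReal_norm]
  ring

lemma MomentBounds.eLpNorm_gradEst_le (hb : MomentBounds (box u) ν p Ft B G LF Gp Lp)
    (h : IsModel (box u) ν p Ft) (hu : ∀ i, 0 < u i) {x : Vec n} (hx : x ∈ box u) :
    eLpNorm (gradEst (box u) p Ft x) 2 (law ν p x) ≤ ENNReal.ofReal (G + B * Gp) := by
  have := h.isProbabilityMeasure_law hx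
  have hB := hb.B_nonneg h hu
  have hs := h.measurable_score hu hx
  have hg := h.measurable_grad hu hx
  have h1 : eLpNorm (fun z => gradientWithin (fun y => Ft y z) (box u) x) 2 (law ν p x)
      ≤ ENNReal.ofReal G := by
    refine (eLpNorm_le_of_ae_bound (C := G) (.of_forall fun z => hb.norm_grad_le x hx z)).trans ?_
    simp
  have hm2 : Measurable fun z => Ft x z • score (box u) p x z := (h.measurable_Ft x hx).smul hs
  have h2 : eLpNorm (fun z => Ft x z • score (box u) p x z) 2 (law ν p x)
      ≤ ENNReal.ofReal (B * Gp) := by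
    rw [ENNReal.ofReal_mul hB]
    refine (eLpNorm_le_mul_eLpNorm_of_ae_le_mul (g := score (box u) p x) (c := B)
      (.of_forall fun z => ?_) 2).trans (by gcongr; exact hb.eLpNorm_score_le h hu hx)
    rw [norm_smul, Real.norm_eq_abs]
    gcongr
    exact hb.abs_Ft_le x hx z
  rw [ENNReal.ofReal_add (hb.G_nonneg h hu) (mul_nonneg hB hb.Gp_nonneg)]
  exact (eLpNorm_add_le hg.aestronglyMeasurable hm2.aestronglyMeasurable one_le_two).trans
    (add_le_add h1 h2)

/-- The Hessian estimate is bounded in `L²` by the smoothness constant. -/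
lemma MomentBounds.eLpNorm_hessEst_le (hb : MomentBounds (box u) ν p Ft B G LF Gp Lp)
    (h : IsModel (box u) ν p Ft) (hu : ∀ i, 0 < u i) {x : Vec n} (hx : x ∈ box u) :
    eLpNorm (hessEst (box u) p Ft x) 2 (law ν p x)
      ≤ ENNReal.ofReal (B * Gp ^ 2 + 2 * G * Gp + LF + B * Lp) := by
  have := h.isProbabilityMeasure_law hx
  have hB := hb.B_nonneg h hu
  have hG := hb.G_nonneg h hu
  have hGp := hb.Gp_nonneg
  have hs := h.measurable_score hu hx
  have hg := h.measurable_grad hu hx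
  have hf := h.measurable_Ft x hx
  have m1 : Measurable fun z => Ft x z • outer (score (box u) p x z) (score (box u) p x z) :=
    hf.smul (measurable_outer hs hs)
  have m2 := measurable_outer hg hs
  have m3 := measurable_outer hs hg
  have m4 : Measurable fun z => hess (box u) (fun y => Ft y z) x :=
    measurable_hess hu h.measurable_Ft h.contDiffOn_Ft hx
  have m5 : Measurable fun z => Ft x z • scoreHess (box u) p x z :=
    hf.smul (h.measurable_scoreHess hu hx)
  have h1 : eLpNorm (fun z => Ft x z • outer (score (box u) p x z) (score (box u) p x z)) 2
      (law ν p x) ≤ ENNReal.ofReal (B * Gp ^ 2) := by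
    rw [ENNReal.ofReal_mul hB]
    refine (eLpNorm_le_mul_eLpNorm_of_ae_le_mul
      (g := fun z => outer (score (box u) p x z) (score (box u) p x z)) (c := B)
      (.of_forall fun z => ?_) 2).trans (by gcongr; exact hb.eLpNorm_outer_score_le hx)
    rw [norm_smul, Real.norm_eq_abs]
    gcongr
    exact hb.abs_Ft_le x hx z
  have h2 : eLpNorm (fun z => outer (gradientWithin (fun y => Ft y z) (box u) x)
      (score (box u) p x z)) 2 (law ν p x) ≤ ENNReal.ofReal (G * Gp) := by
    rw [ENNReal.ofReal_mul hG]
    refine (eLpNorm_le_mul_eLpNorm_of_ae_le_mul (g := score (box u) p x) (c := G)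
      (.of_forall fun z => ?_) 2).trans (by gcongr; exact hb.eLpNorm_score_le h hu hx)
    rw [norm_outer, mul_comm]
    gcongr
    exact hb.norm_grad_le x hx z
  have h3 : eLpNorm (fun z => outer (score (box u) p x z)
      (gradientWithin (fun y => Ft y z) (box u) x)) 2 (law ν p x) ≤ ENNReal.ofReal (G * Gp) := by
    rw [ENNReal.ofReal_mul hG]
    refine (eLpNorm_le_mul_eLpNorm_of_ae_le_mul (g := score (box u) p x) (c := G)
      (.of_forall fun z => ?_) 2).trans (by gcongr; exact hb.eLpNorm_score_le h hu hx)
    rw [norm_outer]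
    gcongr
    exact hb.norm_grad_le x hx z
  have h4 : eLpNorm (fun z => hess (box u) (fun y => Ft y z) x) 2 (law ν p x)
      ≤ ENNReal.ofReal LF := by
    refine (eLpNorm_le_of_ae_bound (C := LF) (.of_forall fun z => hb.norm_hess_le x hx z)).trans ?_
    simp
  have h5 : eLpNorm (fun z => Ft x z • scoreHess (box u) p x z) 2 (law ν p x)
      ≤ ENNReal.ofReal (B * Lp) := by
    have := (eLpNorm_le_ofReal_iff two_ne_zero hb.Lp_nonneg).2 (hb.scoreHess_moment x hx)
    rw [ENNReal.ofReal_mul hB]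
    refine (eLpNorm_le_mul_eLpNorm_of_ae_le_mul (g := scoreHess (box u) p x) (c := B)
      (.of_forall fun z => ?_) 2).trans (by gcongr; exact this)
    rw [norm_smul, Real.norm_eq_abs]
    gcongr
    exact hb.abs_Ft_le x hx z
  have hsum : ENNReal.ofReal (B * Gp ^ 2 + 2 * G * Gp + LF + B * Lp) =
      ENNReal.ofReal (B * Gp ^ 2) + ENNReal.ofReal (G * Gp) + ENNReal.ofReal (G * Gp)
        + ENNReal.ofReal LF + ENNReal.ofReal (B * Lp) := by
    have hLF := hb.LF_nonneg h hu
    have hLp := hb.Lp_nonneg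
    rw [← ENNReal.ofReal_add (by positivity) (by positivity),
      ← ENNReal.ofReal_add (by positivity) (by positivity),
      ← ENNReal.ofReal_add (by positivity) (by positivity),
      ← ENNReal.ofReal_add (by positivity) (by positivity)]
    congr 1; ring
  rw [hsum]
  have m12 := m1.add m2
  have m123 := m12.add m3
  have m1234 := m123.add m4
  have a1 := (eLpNorm_add_le (p := 2) (μ := law ν p x) m1.aestronglyMeasurable
    m2.aestronglyMeasurable one_le_two).trans (add_le_add h1 h2)
  have a2 := (eLpNorm_add_le (p := 2) (μ := law ν p x) m12.aestronglyMeasurable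
    m3.aestronglyMeasurable one_le_two).trans (add_le_add a1 h3)
  have a3 := (eLpNorm_add_le (p := 2) (μ := law ν p x) m123.aestronglyMeasurable
    m4.aestronglyMeasurable one_le_two).trans (add_le_add a2 h4)
  have a4 := (eLpNorm_add_le (p := 2) (μ := law ν p x) m1234.aestronglyMeasurable
    m5.aestronglyMeasurable one_le_two).trans (add_le_add a3 h5)
  exact a4

end Moments

/-! ### The objective is `L`-smooth -/

section Smoothness

variable {n : ℕ} {u : Fin n → ℝ} {Z : Type*} [MeasurableSpace Z] {ν : Measure Z}
  {p Ft : Vec n → Z → ℝ} {B G LF Gp Lp L : ℝ}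

/-- The mean of the gradient estimate, which is the gradient of the objective. -/
def gradMean (X : Set (Vec n)) (ν : Measure Z) (p Ft : Vec n → Z → ℝ) (x : Vec n) : Vec n :=
  ∫ z, gradEst X p Ft x z ∂(law ν p x)

lemma MomentBounds.smoothness_nonneg (hb : MomentBounds (box u) ν p Ft B G LF Gp Lp)
    (h : IsModel (box u) ν p Ft) (hu : ∀ i, 0 < u i) :
    0 ≤ B * Gp ^ 2 + 2 * G * Gp + LF + B * Lp := by
  have := hb.B_nonneg h hu
  have := hb.G_nonneg h hu
  have := hb.LF_nonneg h hu
  have := hb.Gp_nonneg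
  have := hb.Lp_nonneg
  positivity

lemma MomentBounds.integrable_gradEst (hb : MomentBounds (box u) ν p Ft B G LF Gp Lp)
    (h : IsModel (box u) ν p Ft) (hu : ∀ i, 0 < u i) {x : Vec n} (hx : x ∈ box u) :
    Integrable (gradEst (box u) p Ft x) (law ν p x) := by
  have := h.isProbabilityMeasure_law hx
  have h2 : MemLp (gradEst (box u) p Ft x) 2 (law ν p x) :=
    ⟨(h.measurable_gradEst hu hx).aestronglyMeasurable,
      (hb.eLpNorm_gradEst_le h hu hx).trans_lt ENNReal.ofReal_lt_top⟩
  exact h2.integrable one_le_two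

lemma MomentBounds.integrable_Ft (hb : MomentBounds (box u) ν p Ft B G LF Gp Lp)
    (h : IsModel (box u) ν p Ft) {x : Vec n} (hx : x ∈ box u) :
    Integrable (Ft x) (law ν p x) := by
  have := h.isProbabilityMeasure_law hx
  exact Integrable.of_bound (h.measurable_Ft x hx).aestronglyMeasurable B
    (.of_forall fun z => hb.abs_Ft_le x hx z)

lemma MomentBounds.lintegral_p_gradEst_le (hb : MomentBounds (box u) ν p Ft B G LF Gp Lp)
    (h : IsModel (box u) ν p Ft) (hu : ∀ i, 0 < u i) {x : Vec n} (hx : x ∈ box u) :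
    ∫⁻ z, ‖p x z • innerSL ℝ (gradEst (box u) p Ft x z)‖ₑ ∂ν ≤ ENNReal.ofReal (G + B * Gp) := by
  have := h.isProbabilityMeasure_law hx
  have hm := h.measurable_gradEst hu hx
  calc ∫⁻ z, ‖p x z • innerSL ℝ (gradEst (box u) p Ft x z)‖ₑ ∂ν
      = ∫⁻ z, ‖p x z • gradEst (box u) p Ft x z‖ₑ ∂ν := by
        refine lintegral_congr fun z => ?_
        rw [enorm_smul, enorm_smul, ← ofReal_norm (innerSL ℝ _), innerSL_apply_norm, ofReal_norm]
    _ = eLpNorm (gradEst (box u) p Ft x) 1 (law ν p x) := h.lintegral_enorm_p_smul hx hm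
    _ ≤ eLpNorm (gradEst (box u) p Ft x) 2 (law ν p x) :=
        eLpNorm_le_eLpNorm_of_exponent_le one_le_two hm.aestronglyMeasurable
    _ ≤ _ := hb.eLpNorm_gradEst_le h hu hx

lemma MomentBounds.lintegral_p_hessEst_le (hb : MomentBounds (box u) ν p Ft B G LF Gp Lp)
    (h : IsModel (box u) ν p Ft) (hu : ∀ i, 0 < u i) {x : Vec n} (hx : x ∈ box u) :
    ∫⁻ z, ‖p x z • hessEst (box u) p Ft x z‖ₑ ∂ν
      ≤ ENNReal.ofReal (B * Gp ^ 2 + 2 * G * Gp + LF + B * Lp) := by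
  have := h.isProbabilityMeasure_law hx
  have hm := h.measurable_hessEst hu hx
  rw [h.lintegral_enorm_p_smul hx hm]
  exact (eLpNorm_le_eLpNorm_of_exponent_le one_le_two hm.aestronglyMeasurable).trans
    (hb.eLpNorm_hessEst_le h hu hx)

lemma IsModel.measurable_p_smul_gradEst (h : IsModel (box u) ν p Ft) (hu : ∀ i, 0 < u i)
    {x : Vec n} (hx : x ∈ box u) : Measurable fun z => p x z • gradEst (box u) p Ft x z :=
  (h.measurable_p x hx).smul (h.measurable_gradEst hu hx)

variable [SigmaFinite ν]

/-- The Hessian estimate along a segment is unbiased for the increment of the gradient. -/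
lemma MomentBounds.gradMean_sub (hb : MomentBounds (box u) ν p Ft B G LF Gp Lp)
    (h : IsModel (box u) ν p Ft) (hu : ∀ i, 0 < u i) {x y : Vec n} (hx : x ∈ box u)
    (hy : y ∈ box u) :
    gradMean (box u) ν p Ft y - gradMean (box u) ν p Ft x =
      ∫ q, p (segPoint x y q.1) q.2 • hessEst (box u) p Ft (segPoint x y q.1) q.2 (y - x)
        ∂(((volume : Measure ℝ).restrict (Icc 0 1)).prod ν) := by
  rw [gradMean, gradMean, h.integral_law hy, h.integral_law hx]
  exact integral_sub_integral_eq hu (φ' := fun x z => p x z • hessEst (box u) p Ft x z)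
    (fun x hx => h.measurable_p_smul_gradEst hu hx)
    (fun z x hx => h.hasFDerivWithinAt_p_smul_gradEst hu z hx)
    (fun z => (h.continuousOn_p z).smul (h.continuousOn_hessEst hu z))
    (fun x hx => (h.integrable_law_iff hx).1 (hb.integrable_gradEst h hu hx))
    (fun x hx => hb.lintegral_p_hessEst_le h hu hx) hx hy

/-- The derivative of the integrand `p * gradEst` is `p * hessEst`, whose `L¹` norm is at most the
`L²` norm of `hessEst` under the law at that point, hence at most `L`. -/
lemma MomentBounds.norm_gradMean_sub_le (hb : MomentBounds (box u) ν p Ft B G LF Gp Lp)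
    (h : IsModel (box u) ν p Ft) (hu : ∀ i, 0 < u i)
    (hL : B * Gp ^ 2 + 2 * G * Gp + LF + B * Lp ≤ L) {x y : Vec n} (hx : x ∈ box u)
    (hy : y ∈ box u) :
    ‖gradMean (box u) ν p Ft y - gradMean (box u) ν p Ft x‖ ≤ L * ‖y - x‖ := by
  rw [gradMean, gradMean, h.integral_law hy, h.integral_law hx]
  exact norm_integral_sub_integral_le hu (φ' := fun x z => p x z • hessEst (box u) p Ft x z)
    (fun x hx => h.measurable_p_smul_gradEst hu hx)
    (fun z x hx => h.hasFDerivWithinAt_p_smul_gradEst hu z hx)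
    (fun z => (h.continuousOn_p z).smul (h.continuousOn_hessEst hu z))
    (fun x hx => (h.integrable_law_iff hx).1 (hb.integrable_gradEst h hu hx))
    ((hb.smoothness_nonneg h hu).trans hL)
    (fun x hx => (hb.lintegral_p_hessEst_le h hu hx).trans (ENNReal.ofReal_le_ofReal hL)) hx hy

/-- The integrated form of "`gradMean` is the gradient of the objective"; differentiability of the
objective itself is never used. -/
lemma MomentBounds.objective_sub (hb : MomentBounds (box u) ν p Ft B G LF Gp Lp)
    (h : IsModel (box u) ν p Ft) (hu : ∀ i, 0 < u i) {x y : Vec n} (hx : x ∈ box u)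
    (hy : y ∈ box u) :
    objective ν p Ft y - objective ν p Ft x =
      ∫ a in Icc (0 : ℝ) 1, inner ℝ (gradMean (box u) ν p Ft (segPoint x y a)) (y - x) := by
  have hm : ∀ x ∈ box u, Measurable fun z => p x z • Ft x z := fun x hx =>
    (h.measurable_p x hx).smul (h.measurable_Ft x hx)
  have hc : ∀ z, ContinuousOn (fun x => p x z • innerSL ℝ (gradEst (box u) p Ft x z)) (box u) :=
    fun z => (h.continuousOn_p z).smul
      ((innerSL ℝ).continuous.comp_continuousOn (h.continuousOn_gradEst hu z))
  have hd := fun z x (hx : x ∈ box u) => h.hasFDerivWithinAt_p_mul_Ft z hx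
  have hK := fun x (hx : x ∈ box u) => hb.lintegral_p_gradEst_le h hu hx
  rw [objective, objective, h.integral_law hy, h.integral_law hx,
    integral_sub_integral_eq hu (φ' := fun x z => p x z • innerSL ℝ (gradEst (box u) p Ft x z))
      hm hd hc (fun x hx => (h.integrable_law_iff hx).1 (hb.integrable_Ft h hx)) hK hx hy,
    integral_prod _ (integrable_segPoint_of_lintegral_le hu
      (φ' := fun x z => p x z • innerSL ℝ (gradEst (box u) p Ft x z)) hm hd hc hK hx hy)]
  refine setIntegral_congr_fun measurableSet_Icc fun a ha => ?_
  have hw := segPoint_mem (convex_box u) hx hy ha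
  simp only [gradMean, h.integral_law hw]
  rw [real_inner_comm, ← integral_inner ((h.integrable_law_iff hw).1
    (hb.integrable_gradEst h hu hw))]
  refine integral_congr_ae (.of_forall fun z => ?_)
  simp only [smul_apply, innerSL_apply_apply, inner_smul_right, smul_eq_mul]
  rw [real_inner_comm]

/-- First-order Taylor bound: the objective is `L`-smooth on the box. -/
lemma MomentBounds.abs_objective_sub_inner_le (hb : MomentBounds (box u) ν p Ft B G LF Gp Lp)
    (h : IsModel (box u) ν p Ft) (hu : ∀ i, 0 < u i)
    (hL : B * Gp ^ 2 + 2 * G * Gp + LF + B * Lp ≤ L) {x y : Vec n} (hx : x ∈ box u)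
    (hy : y ∈ box u) :
    |objective ν p Ft y - objective ν p Ft x - inner ℝ (gradMean (box u) ν p Ft x) (y - x)|
      ≤ L / 2 * ‖y - x‖ ^ 2 := by
  have hlip := fun x (hx : x ∈ box u) y (hy : y ∈ box u) =>
    hb.norm_gradMean_sub_le h hu hL hx hy
  have hL0 := (hb.smoothness_nonneg h hu).trans hL
  have hcont : ContinuousOn (gradMean (box u) ν p Ft) (box u) := by
    refine (LipschitzOnWith.of_dist_le_mul (K := ⟨L, hL0⟩) fun y hy x hx => ?_).continuousOn
    rw [dist_eq_norm, dist_eq_norm]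
    exact hlip x hx y hy
  have hi : IntegrableOn (fun a =>
      inner ℝ (gradMean (box u) ν p Ft (segPoint x y a)) (y - x)) (Icc (0 : ℝ) 1) :=
    ((continuousOn_comp_segPoint (convex_box u) hcont hx hy).inner
      continuousOn_const).integrableOn_Icc
  have hconst : inner ℝ (gradMean (box u) ν p Ft x) (y - x) =
      ∫ _ in Icc (0 : ℝ) 1, inner ℝ (gradMean (box u) ν p Ft x) (y - x) := by simp
  rw [hb.objective_sub h hu hx hy, hconst, ← integral_sub hi (integrable_const _),
    ← Real.norm_eq_abs]
  have hbd : IntegrableOn (fun a : ℝ => L * ‖y - x‖ ^ 2 * a) (Icc (0 : ℝ) 1) :=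
    (by fun_prop : Continuous fun a : ℝ => L * ‖y - x‖ ^ 2 * a).integrableOn_Icc
  refine (norm_integral_le_of_norm_le hbd ?_).trans (le_of_eq ?_)
  · filter_upwards [ae_restrict_mem measurableSet_Icc] with a ha
    rw [← inner_sub_left, Real.norm_eq_abs]
    refine (abs_real_inner_le_norm _ _).trans ?_
    have h1 := hlip x hx _ (segPoint_mem (convex_box u) hx hy ha)
    rw [segPoint_sub, norm_smul, Real.norm_of_nonneg ha.1] at h1
    calc _ ≤ L * (a * ‖y - x‖) * ‖y - x‖ := by gcongr
      _ = _ := by ring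
  · rw [integral_const_mul, integral_Icc_eq_integral_Ioc,
      ← intervalIntegral.integral_of_le zero_le_one, integral_id]
    ring

end Smoothness

/-! ### First-order inequalities for monotone DR-submodular functions -/

section Submodular

variable {n : ℕ} {u : Fin n → ℝ} {F : Vec n → ℝ} {g : Vec n → Vec n} {L : ℝ}

/-- Removes the Taylor remainder: a displacement cut into `N` pieces leaves a total quadratic error
of order `1 / N`. -/
lemma le_of_forall_le_add_div {a b c : ℝ} (h : ∀ N : ℕ, 1 ≤ N → a ≤ b + c / N) : a ≤ b := by
  refine ge_of_tendsto (f := fun N : ℕ => b + c / N) (x := Filter.atTop) ?_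
    (Filter.eventually_atTop.2 ⟨1, h⟩)
  simpa using tendsto_const_nhds.add (tendsto_const_div_atTop_nhds_zero_nat c)

lemma mem_box_of_le_of_le {x y w : Vec n} (hx : x ∈ box u) (hy : y ∈ box u)
    (h1 : ∀ i, x i ≤ w i) (h2 : ∀ i, w i ≤ y i) : w ∈ box u :=
  fun i => ⟨(hx i).1.trans (h1 i), (h2 i).trans (hy i).2⟩

lemma add_single_apply (x : Vec n) (i j : Fin n) (k : ℝ) :
    (x + EuclideanSpace.single i k) j = x j + if j = i then k else 0 := by
  simp

lemma add_single_mem_of_le {x : Vec n} (hx : x ∈ box u) {i : Fin n} {k l : ℝ} (hk : 0 ≤ k)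
    (hkl : k ≤ l) (hl : x + EuclideanSpace.single i l ∈ box u) :
    x + EuclideanSpace.single i k ∈ box u := by
  refine mem_box_of_le_of_le hx hl (fun j => ?_) fun j => ?_
  · rw [add_single_apply]; split_ifs <;> linarith
  · rw [add_single_apply, add_single_apply]; split_ifs <;> linarith

/-- Along a coordinate, a smooth DR-submodular function lies below its tangent. -/
lemma DRSubmodular.add_single_sub_le (hDR : DRSubmodular (box u) F)
    (hg : ∀ x ∈ box u, ∀ y ∈ box u, |F y - F x - inner ℝ (g x) (y - x)| ≤ L / 2 * ‖y - x‖ ^ 2)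
    {x : Vec n} (hx : x ∈ box u) {i : Fin n} {k : ℝ} (hk : 0 ≤ k)
    (hxk : x + EuclideanSpace.single i k ∈ box u) :
    F (x + EuclideanSpace.single i k) - F x ≤ k * g x i := by
  -- Cut the move into `N` steps of length `k / N`. By diminishing returns each step gains at most
  -- what the first one does, and Taylor is applied to the first step only. The remainder is `N * (L
  -- / 2) * (k / N) ^ 2`.
  refine le_of_forall_le_add_div (c := L / 2 * k ^ 2) fun N hN => ?_
  have hN0 : (0 : ℝ) < N := by exact_mod_cast hN
  have hkN : 0 ≤ k / N := by positivity
  have hmem : ∀ l : ℕ, l ≤ N → x + EuclideanSpace.single i (l * (k / N)) ∈ box u := by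
    intro l hl
    refine add_single_mem_of_le hx (by positivity) ?_ hxk
    have : (l : ℝ) ≤ N := by exact_mod_cast hl
    calc l * (k / N) ≤ N * (k / N) := by gcongr
      _ = k := by field_simp
  have hstep : ∀ l : ℕ, l ≤ N → F (x + EuclideanSpace.single i (l * (k / N))) - F x
      ≤ l * (F (x + EuclideanSpace.single i (k / N)) - F x) := by
    intro l
    induction l with
    | zero =>
      have h0 : EuclideanSpace.single i (0 : ℝ) = (0 : Vec n) := by ext j; simp
      simp [h0]
    | succ l ih =>
      intro hl
      have hsum : x + EuclideanSpace.single i (l * (k / N)) + EuclideanSpace.single i (k / N)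
          = x + EuclideanSpace.single i ((l + 1 : ℕ) * (k / N)) := by
        rw [add_assoc]
        congr 1
        ext j
        simp only [PiLp.add_apply, PiLp.single_apply]
        split_ifs
        · push_cast; ring
        · simp
      have h1 := hDR x hx _ (hmem l (by omega)) (fun j => by
        rw [add_single_apply]
        have : 0 ≤ l * (k / N) := by positivity
        split_ifs <;> linarith) i (k / N) hkN (by simpa using hmem 1 hN)
        (by rw [hsum]; exact hmem _ hl)
      rw [hsum] at h1
      have h2 := ih (by omega)
      push_cast at h1 ⊢
      linarith
  have h1 := hstep N le_rfl
  rw [show N * (k / N) = k by field_simp] at h1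
  have hmem1 : x + EuclideanSpace.single i (k / N) ∈ box u := by simpa using hmem 1 hN
  have h2 := (abs_le.1 (hg x hx _ hmem1)).2
  rw [add_sub_cancel_left, EuclideanSpace.inner_single_right, PiLp.norm_single,
    Real.norm_eq_abs, sq_abs] at h2
  simp only [conj_trivial] at h2
  calc _ ≤ N * (F (x + EuclideanSpace.single i (k / N)) - F x) := h1
    _ ≤ N * (k / N * g x i + L / 2 * (k / N) ^ 2) := by gcongr; linarith
    _ = _ := by field_simp

/-- A short move along the coordinate, upwards from the lower half of the interval and downwards
from the upper half, stays in the box. Monotonicity and the Taylor bound then give `g x i ≥ -(L / 2)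
k` for arbitrarily small `k`. -/
lemma MonotoneObj.gradient_nonneg (hmono : MonotoneObj (box u) F) (hu : ∀ i, 0 < u i)
    (hg : ∀ x ∈ box u, ∀ y ∈ box u, |F y - F x - inner ℝ (g x) (y - x)| ≤ L / 2 * ‖y - x‖ ^ 2)
    {x : Vec n} (hx : x ∈ box u) (i : Fin n) : 0 ≤ g x i := by
  have key : ∀ k : ℝ, x + EuclideanSpace.single i k ∈ box u →
      |F (x + EuclideanSpace.single i k) - F x - k * g x i| ≤ L / 2 * k ^ 2 := by
    intro k hk
    have := hg x hx _ hk
    rwa [add_sub_cancel_left, EuclideanSpace.inner_single_right, PiLp.norm_single,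
      Real.norm_eq_abs, sq_abs, conj_trivial] at this
  have hui := hu i
  refine le_of_forall_le_add_div (c := L / 2 * (u i / 2)) fun N hN => ?_
  have hN0 : (0 : ℝ) < N := by exact_mod_cast hN
  have hN1 : (1 : ℝ) ≤ N := by exact_mod_cast hN
  set k := u i / 2 / N with hk
  have hk0 : 0 < k := by positivity
  have hkle : k ≤ u i / 2 := div_le_self (by positivity) hN1
  have hgoal : 0 ≤ g x i + L / 2 * k := by
    rcases le_total (x i) (u i / 2) with hxi | hxi
    · have hmem : x + EuclideanSpace.single i k ∈ box u := by
        intro j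
        rw [add_single_apply]
        have := hx j
        split_ifs with hj
        · subst hj; constructor <;> linarith
        · simpa using this
      have h1 := (abs_le.1 (key k hmem)).2
      have h2 := hmono x hx _ hmem fun j => by rw [add_single_apply]; split_ifs <;> linarith
      by_contra! hneg
      nlinarith
    · have hmem : x + EuclideanSpace.single i (-k) ∈ box u := by
        intro j
        rw [add_single_apply]
        have := hx j
        split_ifs with hj
        · subst hj; constructor <;> linarith
        · simpa using this
      have h1 := (abs_le.1 (key (-k) hmem)).1
      have h2 := hmono _ hmem x hx fun j => by rw [add_single_apply]; split_ifs <;> linarith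
      by_contra! hneg
      nlinarith
  calc (0 : ℝ) ≤ g x i + L / 2 * k := hgoal
    _ = _ := by rw [hk]; ring

/-- A smooth DR-submodular function lies below its tangent along nonnegative directions. -/
lemma DRSubmodular.sub_le_inner (hDR : DRSubmodular (box u) F)
    (hg : ∀ x ∈ box u, ∀ y ∈ box u, |F y - F x - inner ℝ (g x) (y - x)| ≤ L / 2 * ‖y - x‖ ^ 2)
    {x y : Vec n} (hx : x ∈ box u) (hy : y ∈ box u) (hxy : ∀ i, x i ≤ y i) :
    F y - F x ≤ inner ℝ (g x) (y - x) := by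
  classical
  -- Coordinates are raised from `x` to `y` one at a time. Diminishing returns replaces the
  -- increment at the intermediate point `w` by the same increment at `x`, so every term involves
  -- the gradient at `x` alone.
  have key : ∀ s : Finset (Fin n),
      F (WithLp.toLp 2 fun i => if i ∈ s then y i else x i) - F x
        ≤ ∑ i ∈ s, (y i - x i) * g x i := by
    intro s
    induction s using Finset.induction_on with
    | empty => simp
    | insert i s hi ih =>
      rw [Finset.sum_insert hi]
      set w : Vec n := WithLp.toLp 2 fun i => if i ∈ s then y i else x i with hw
      have hwx : ∀ j, w j = if j ∈ s then y j else x j := fun j => rfl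
      have hle1 : ∀ j, x j ≤ w j := fun j => by
        rw [hwx]; split_ifs
        · exact hxy j
        · exact le_rfl
      have hle2 : ∀ j, w j ≤ y j := fun j => by
        rw [hwx]; split_ifs
        · exact le_rfl
        · exact hxy j
      have hwm := mem_box_of_le_of_le hx hy hle1 hle2
      have hins : (WithLp.toLp 2 fun j => if j ∈ insert i s then y j else x j)
          = w + EuclideanSpace.single i (y i - x i) := by
        ext j
        rw [add_single_apply, hwx]
        by_cases hj : j = i
        · subst hj; simp [hi]
        · simp [hj]
      have hm1 : w + EuclideanSpace.single i (y i - x i) ∈ box u := by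
        refine mem_box_of_le_of_le hx hy (fun j => ?_) fun j => ?_
        · rw [add_single_apply]
          have := hxy i
          have := hle1 j
          split_ifs <;> linarith
        · rw [add_single_apply, hwx]
          by_cases hj : j = i
          · subst hj; simp [hi]
          · simp only [hj, if_false, add_zero]; exact hle2 j
      have hm2 : x + EuclideanSpace.single i (y i - x i) ∈ box u := by
        refine mem_box_of_le_of_le hx hm1 (fun j => ?_) fun j => ?_
        · rw [add_single_apply]
          have := hxy i
          split_ifs <;> linarith
        · rw [add_single_apply, add_single_apply]
          linarith [hle1 j]
      have h1 := hDR x hx w hwm hle1 i (y i - x i) (by linarith [hxy i]) hm2 hm1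
      have h2 := hDR.add_single_sub_le hg hx (by linarith [hxy i]) hm2
      rw [hins]
      linarith
  have h := key Finset.univ
  simp only [Finset.mem_univ, if_true] at h
  refine h.trans (le_of_eq ?_)
  simp [PiLp.inner_apply]

/-- The inequality that drives Frank–Wolfe for monotone DR-submodular functions. -/
lemma DRSubmodular.sub_le_inner_of_monotone (hDR : DRSubmodular (box u) F)
    (hmono : MonotoneObj (box u) F) (hu : ∀ i, 0 < u i)
    (hg : ∀ x ∈ box u, ∀ y ∈ box u, |F y - F x - inner ℝ (g x) (y - x)| ≤ L / 2 * ‖y - x‖ ^ 2)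
    {x y : Vec n} (hx : x ∈ box u) (hy : y ∈ box u) : F y - F x ≤ inner ℝ (g x) y := by
  -- Compare through the join `w = x ∨ y`: `F y ≤ F w` by monotonicity, and `w - x ≤ y`
  -- coordinatewise because `x` and `y` are nonnegative.
  set w : Vec n := WithLp.toLp 2 fun i => max (x i) (y i) with hw
  have hwm : w ∈ box u := fun i =>
    ⟨le_max_of_le_left (hx i).1, max_le (hx i).2 (hy i).2⟩
  have h1 := hmono y hy w hwm fun i => le_max_right _ _
  have h2 := hDR.sub_le_inner hg hx hwm fun i => le_max_left _ _
  have h3 : inner ℝ (g x) (w - x) ≤ inner ℝ (g x) y := by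
    simp only [PiLp.inner_apply, RCLike.inner_apply, conj_trivial]
    refine Finset.sum_le_sum fun i _ =>
      mul_le_mul_of_nonneg_right ?_ (hmono.gradient_nonneg hu hg hx i)
    have : w i = max (x i) (y i) := rfl
    rw [PiLp.sub_apply, this, sub_le_iff_le_add]
    exact max_le (by linarith [(hy i).1]) (by linarith [(hx i).1])
  linarith

end Submodular

/-! ### Second moments of batch averages -/

section Batch

variable {α : Type*} [MeasurableSpace α] {μ : Measure α} [IsProbabilityMeasure μ] {m : ℕ}

/-- The random variable has mean `e` and variance `Var f / m`, by independence. The shift `e` plays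
the role of the error inherited from the past: it is constant once the past is fixed, and its cross
term with the centred average vanishes. -/
lemma integral_sq_add_sub_average_le (hm : 0 < m) {f : α → ℝ} (hf : MemLp f 2 μ) (e : ℝ) :
    MemLp (fun b : Fin m → α => e + (∫ z, f z ∂μ - (m : ℝ)⁻¹ * ∑ i, f (b i))) 2
        (Measure.pi fun _ => μ) ∧
      ∫ b : Fin m → α, (e + (∫ z, f z ∂μ - (m : ℝ)⁻¹ * ∑ i, f (b i))) ^ 2
        ∂(Measure.pi fun _ => μ) ≤ e ^ 2 + (∫ z, f z ^ 2 ∂μ) / m := by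
  have hm0 : (m : ℝ) ≠ 0 := by positivity
  set c := ∫ z, f z ∂μ with hc
  have hi : ∀ i : Fin m, MemLp (fun b : Fin m → α => f (b i)) 2 (Measure.pi fun _ => μ) :=
    fun i => hf.comp_measurePreserving (measurePreserving_eval _ i)
  have hS : MemLp (fun b : Fin m → α => ∑ i, f (b i)) 2 (Measure.pi fun _ => μ) :=
    memLp_finsetSum _ fun i _ => hi i
  have hA : MemLp (fun b : Fin m → α => (m : ℝ)⁻¹ * ∑ i, f (b i)) 2 (Measure.pi fun _ => μ) :=
    hS.const_mul _
  have hD : MemLp (fun b : Fin m → α => c - (m : ℝ)⁻¹ * ∑ i, f (b i)) 2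
      (Measure.pi fun _ => μ) := (memLp_const c).sub hA
  have hR : MemLp (fun b : Fin m → α => e + (c - (m : ℝ)⁻¹ * ∑ i, f (b i))) 2
      (Measure.pi fun _ => μ) := (memLp_const e).add hD
  refine ⟨hR, ?_⟩
  have hvar : Var[fun b : Fin m → α => e + (c - (m : ℝ)⁻¹ * ∑ i, f (b i)); Measure.pi fun _ => μ]
      = Var[f; μ] / m := by
    rw [variance_const_add hD.aestronglyMeasurable, variance_const_sub hA.aestronglyMeasurable,
      variance_const_mul]
    have := variance_sum_pi (μ := fun _ : Fin m => μ) (X := fun _ => f) fun _ => hf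
    have he : (∑ i : Fin m, fun ω : Fin m → α => f (ω i)) = fun b => ∑ i, f (b i) := by
      ext b; simp
    rw [he] at this
    rw [this]
    simp only [Finset.sum_const, Finset.card_univ, Fintype.card_fin, nsmul_eq_mul]
    field_simp
  have hmean : ∫ b : Fin m → α, (e + (c - (m : ℝ)⁻¹ * ∑ i, f (b i))) ∂(Measure.pi fun _ => μ)
      = e := by
    rw [integral_add (integrable_const _) (hD.integrable one_le_two),
      integral_sub (integrable_const _) (hA.integrable one_le_two), integral_const_mul,
      integral_finsetSum _ fun i _ => (hi i).integrable one_le_two]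
    have : ∀ i : Fin m, ∫ b : Fin m → α, f (b i) ∂(Measure.pi fun _ => μ) = c := fun i =>
      integral_comp_eval (μ := fun _ : Fin m => μ) hf.aestronglyMeasurable
    simp [this, hm0]
  have h1 := variance_eq_sub hR
  rw [hvar, hmean] at h1
  have h2 := variance_le_expectation_sq (μ := μ) hf.aestronglyMeasurable
  simp only [Pi.pow_apply] at h1 h2
  have h3 : Var[f; μ] / m ≤ (∫ z, f z ^ 2 ∂μ) / m := by gcongr
  linarith

/-- The mean squared error of a batch average. -/
lemma lintegral_enorm_sq_add_sub_average_le {n : ℕ} (hm : 0 < m) {f : α → Vec n}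
    (hf : AEStronglyMeasurable f μ) {σ : ℝ} (hσ : ∫⁻ z, ‖f z‖ₑ ^ 2 ∂μ ≤ ENNReal.ofReal (σ ^ 2))
    (e : Vec n) :
    ∫⁻ b : Fin m → α, ‖e + (∫ z, f z ∂μ - (m : ℝ)⁻¹ • ∑ i, f (b i))‖ₑ ^ 2 ∂(Measure.pi fun _ => μ)
      ≤ ENNReal.ofReal (‖e‖ ^ 2 + σ ^ 2 / m) := by
  have hL : MemLp f 2 μ := by
    refine ⟨hf, ((eLpNorm_le_ofReal_iff (k := 2) two_ne_zero (abs_nonneg σ)).2 ?_).trans_lt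
      ENNReal.ofReal_lt_top⟩
    rwa [sq_abs]
  let π (j : Fin n) : Vec n →L[ℝ] ℝ := EuclideanSpace.proj j
  have hj : ∀ j, MemLp (fun z => f z j) 2 μ := fun j => (π j).comp_memLp' hL
  have hc : ∀ j, (∫ z, f z ∂μ) j = ∫ z, f z j ∂μ := fun j =>
    ((π j).integral_comp_comm (hL.integrable one_le_two)).symm
  have hint : Integrable (fun z => ‖f z‖ ^ 2) μ := hL.integrable_norm_pow two_ne_zero
  have hsq : ∀ v : Vec n, ‖v‖ₑ ^ 2 = ENNReal.ofReal (‖v‖ ^ 2) := fun v => by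
    rw [← ofReal_norm, ENNReal.ofReal_pow (norm_nonneg _)]
  have hσ' : ∫ z, ‖f z‖ ^ 2 ∂μ ≤ σ ^ 2 := by
    simp_rw [hsq] at hσ
    rw [← ofReal_integral_eq_lintegral_ofReal hint (.of_forall fun _ => by positivity)] at hσ
    rwa [ENNReal.ofReal_le_ofReal_iff (by positivity)] at hσ
  -- The Euclidean norm splits the vector statement into the scalar one in each coordinate, without
  -- loss of constant.
  have hexp : ∀ b : Fin m → α, ‖e + (∫ z, f z ∂μ - (m : ℝ)⁻¹ • ∑ i, f (b i))‖ ^ 2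
      = ∑ j, (e j + (∫ z, f z j ∂μ - (m : ℝ)⁻¹ * ∑ i, f (b i) j)) ^ 2 := by
    intro b
    rw [EuclideanSpace.real_norm_sq_eq]
    simp [hc]
  have key := fun j => integral_sq_add_sub_average_le hm (hj j) (e j)
  have hintj := fun j => (key j).1.integrable_sq
  simp_rw [hsq, hexp]
  rw [← ofReal_integral_eq_lintegral_ofReal (integrable_finsetSum _ fun j _ => hintj j)
    (.of_forall fun _ => Finset.sum_nonneg fun j _ => sq_nonneg _)]
  refine ENNReal.ofReal_le_ofReal ?_
  rw [integral_finsetSum _ fun j _ => hintj j]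
  calc _ ≤ ∑ j, (e j ^ 2 + (∫ z, f z j ^ 2 ∂μ) / m) := Finset.sum_le_sum fun j _ => (key j).2
    _ = ‖e‖ ^ 2 + (∫ z, ‖f z‖ ^ 2 ∂μ) / m := by
      simp_rw [EuclideanSpace.real_norm_sq_eq]
      rw [Finset.sum_add_distrib, ← Finset.sum_div,
        integral_finsetSum _ fun j _ => (hj j).integrable_sq]
    _ ≤ _ := by gcongr

end Batch

/-! ### The sampling law along a segment, as a kernel -/

section SegmentLaw

variable {n : ℕ} {u : Fin n → ℝ} {Z : Type*} [MeasurableSpace Z] {ν : Measure Z}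
  {p Ft : Vec n → Z → ℝ} {B G LF Gp Lp L : ℝ}

/-- The law of one sample along a segment, with the points projected onto the box. -/
def clampedSegLaw (u : Fin n → ℝ) (ν : Measure Z) (p : Vec n → Z → ℝ) (q : Vec n × Vec n) :
    Measure (ℝ × Z) :=
  segLaw ν (fun w => p (clamp u w)) q.1 q.2

lemma IsModel.measurable_clamped_density (h : IsModel (box u) ν p Ft) (hu : ∀ i, 0 < u i) :
    Measurable fun r : (Vec n × Vec n) × (ℝ × Z) =>
      ENNReal.ofReal (p (clamp u (segPoint r.1.1 r.1.2 r.2.1)) r.2.2) := by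
  have hseg : Measurable fun r : (Vec n × Vec n) × (ℝ × Z) =>
      (segPoint r.1.1 r.1.2 r.2.1, r.2.2) := by
    have h1 : Measurable fun r : (Vec n × Vec n) × (ℝ × Z) => (r.1, r.2.1) := by fun_prop
    exact (continuous_segPoint_uncurry.measurable.comp h1).prodMk (by fun_prop)
  exact ((measurable_clamp_uncurry hu (fun z => h.continuousOn_p z) h.measurable_p).comp
    hseg).ennreal_ofReal

lemma IsModel.measurable_clamped_density_left (h : IsModel (box u) ν p Ft) (hu : ∀ i, 0 < u i)
    (x y : Vec n) :
    Measurable fun r : ℝ × Z => ENNReal.ofReal (p (clamp u (segPoint x y r.1)) r.2) := by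
  have h1 := (h.measurable_clamped_density hu).comp (measurable_prodMk_left (x := (x, y)))
  exact h1

lemma IsModel.measurable_clamped_hessEst (h : IsModel (box u) ν p Ft) (hu : ∀ i, 0 < u i) :
    Measurable fun r : (Vec n × Vec n) × (ℝ × Z) =>
      hessEst (box u) p Ft (clamp u (segPoint r.1.1 r.1.2 r.2.1)) r.2.2 (r.1.2 - r.1.1) := by
  have hseg : Measurable fun r : (Vec n × Vec n) × (ℝ × Z) =>
      (segPoint r.1.1 r.1.2 r.2.1, r.2.2) := by
    have h1 : Measurable fun r : (Vec n × Vec n) × (ℝ × Z) => (r.1, r.2.1) := by fun_prop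
    exact (continuous_segPoint_uncurry.measurable.comp h1).prodMk (by fun_prop)
  have h1 := (measurable_clamp_uncurry hu (fun z => h.continuousOn_hessEst hu z)
    fun x hx => h.measurable_hessEst hu hx).comp hseg
  have h2 : Measurable fun r : (Vec n × Vec n) × (ℝ × Z) => r.1.2 - r.1.1 := by fun_prop
  have h3 := (isBoundedBilinearMap_apply (𝕜 := ℝ) (E := Vec n) (F := Vec n)).continuous.measurable
  have h4 := h3.comp (h1.prodMk h2)
  exact h4

lemma IsModel.measurable_clamped_hessEst_left (h : IsModel (box u) ν p Ft) (hu : ∀ i, 0 < u i)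
    (x y : Vec n) : Measurable fun r : ℝ × Z =>
      hessEst (box u) p Ft (clamp u (segPoint x y r.1)) r.2 (y - x) := by
  have h1 := (h.measurable_clamped_hessEst hu).comp (measurable_prodMk_left (x := (x, y)))
  exact h1

variable [SigmaFinite ν]

lemma segLaw_eq_clampedSegLaw {x y : Vec n} (hx : x ∈ box u) (hy : y ∈ box u) :
    segLaw ν p x y = clampedSegLaw u ν p (x, y) := by
  refine withDensity_congr_ae ?_
  filter_upwards [ae_prod_fst_mem_Icc ν] with q hq
  simp only [clamp_of_mem (segPoint_mem (convex_box u) hx hy hq)]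

lemma IsModel.isProbabilityMeasure_clampedSegLaw (h : IsModel (box u) ν p Ft) (hu : ∀ i, 0 < u i)
    (q : Vec n × Vec n) : IsProbabilityMeasure (clampedSegLaw u ν p q) := by
  refine ⟨?_⟩
  have hm := h.measurable_clamped_density_left hu q.1 q.2
  rw [clampedSegLaw, segLaw, withDensity_apply _ .univ, Measure.restrict_univ,
    lintegral_prod _ hm.aemeasurable]
  simp_rw [h.p_total _ (clamp_mem hu _)]
  simp

lemma IsModel.measurable_clampedSegLaw (h : IsModel (box u) ν p Ft) (hu : ∀ i, 0 < u i) :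
    Measurable (clampedSegLaw u ν p) := by
  refine Measure.measurable_of_measurable_coe _ fun S hS => ?_
  have : (fun q => clampedSegLaw u ν p q S) = fun q => ∫⁻ r,
      ENNReal.ofReal (p (clamp u (segPoint q.1 q.2 r.1)) r.2)
        ∂((((volume : Measure ℝ).restrict (Icc 0 1)).prod ν).restrict S) := by
    funext q
    rw [clampedSegLaw, segLaw, withDensity_apply _ hS]
  rw [this]
  exact (h.measurable_clamped_density hu).lintegral_prod_right'

/-- The law of a batch of `m` samples along a segment, as a kernel. -/
lemma IsModel.measurable_pi_clampedSegLaw (h : IsModel (box u) ν p Ft) (hu : ∀ i, 0 < u i)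
    (m : ℕ) :
    Measurable fun q : Vec n × Vec n => Measure.pi fun _ : Fin m => clampedSegLaw u ν p q := by
  have hP := h.isProbabilityMeasure_clampedSegLaw hu
  -- Rectangles form a generating π-system, and on them the product measure is a finite product of
  -- measurable functions.
  refine Measurable.measure_of_isPiSystem_of_isProbabilityMeasure generateFrom_pi.symm isPiSystem_pi
    fun S hS => ?_
  obtain ⟨s, hs, rfl⟩ := hS
  simp_rw [Measure.pi_pi]
  refine Finset.measurable_prod _ fun i _ => ?_
  have hsi : MeasurableSet (s i) := hs i (mem_univ i)
  exact (Measure.measurable_coe hsi).comp (h.measurable_clampedSegLaw hu)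

/-- Unbiasedness of one sample: the density turns the integral into that of `p * hessEst` along the
segment, and the projection is inactive because positions lie in `[0, 1]` almost everywhere. -/
lemma MomentBounds.integral_clampedSegLaw (hb : MomentBounds (box u) ν p Ft B G LF Gp Lp)
    (h : IsModel (box u) ν p Ft) (hu : ∀ i, 0 < u i) {x y : Vec n} (hx : x ∈ box u)
    (hy : y ∈ box u) :
    ∫ q, hessEst (box u) p Ft (clamp u (segPoint x y q.1)) q.2 (y - x)
        ∂(clampedSegLaw u ν p (x, y))
      = gradMean (box u) ν p Ft y - gradMean (box u) ν p Ft x := by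
  have hm := h.measurable_clamped_density_left hu x y
  rw [clampedSegLaw, segLaw, integral_withDensity_eq_integral_toReal_smul hm
    (.of_forall fun _ => ENNReal.ofReal_lt_top), hb.gradMean_sub h hu hx hy]
  refine integral_congr_ae ?_
  filter_upwards [ae_prod_fst_mem_Icc ν] with q hq
  have hw := segPoint_mem (convex_box u) hx hy hq
  simp only [clamp_of_mem hw, ENNReal.toReal_ofReal (h.p_pos _ hw _).le]

/-- Given the position `a`, the sample has law `p(·; x(a))`, where the `L²` bound on `hessEst`
applies; the bound is uniform in `a`. -/
lemma MomentBounds.lintegral_clampedSegLaw_le (hb : MomentBounds (box u) ν p Ft B G LF Gp Lp)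
    (h : IsModel (box u) ν p Ft) (hu : ∀ i, 0 < u i)
    (hL : B * Gp ^ 2 + 2 * G * Gp + LF + B * Lp ≤ L) {x y : Vec n} (hx : x ∈ box u)
    (hy : y ∈ box u) :
    ∫⁻ q, ‖hessEst (box u) p Ft (clamp u (segPoint x y q.1)) q.2 (y - x)‖ₑ ^ 2
        ∂(clampedSegLaw u ν p (x, y)) ≤ ENNReal.ofReal ((L * ‖y - x‖) ^ 2) := by
  have hL0 := hb.smoothness_nonneg h hu
  have hm := h.measurable_clamped_density_left hu x y
  have hm2 := (h.measurable_clamped_hessEst_left hu x y).enorm.pow_const 2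
  have e1 := lintegral_withDensity_eq_lintegral_mul
    (((volume : Measure ℝ).restrict (Icc 0 1)).prod ν) hm hm2
  have e2 := lintegral_prod (μ := (volume : Measure ℝ).restrict (Icc 0 1)) (ν := ν) _
    (hm.mul hm2).aemeasurable
  refine (e1.trans e2).trans_le ?_
  calc _ ≤ ∫⁻ _ in Icc (0 : ℝ) 1, ENNReal.ofReal ((L * ‖y - x‖) ^ 2) := ?_
    _ = _ := by simp
  refine setLIntegral_mono' measurableSet_Icc fun a ha => ?_
  have hw := segPoint_mem (convex_box u) hx hy ha
  simp only [Pi.mul_apply, clamp_of_mem hw]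
  have hmh := h.measurable_hessEst hu hw
  have e3 := lintegral_withDensity_eq_lintegral_mul ν (h.measurable_p _ hw).ennreal_ofReal
    ((hmh.apply_continuousLinearMap (y - x)).enorm.pow_const 2)
  refine e3.symm.trans_le ?_
  calc ∫⁻ z, ‖hessEst (box u) p Ft (segPoint x y a) z (y - x)‖ₑ ^ 2 ∂(law ν p (segPoint x y a))
      ≤ ∫⁻ z, ‖hessEst (box u) p Ft (segPoint x y a) z‖ₑ ^ 2 * ‖y - x‖ₑ ^ 2
          ∂(law ν p (segPoint x y a)) := by
        refine lintegral_mono fun z => ?_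
        rw [← mul_pow]
        gcongr
        exact ContinuousLinearMap.le_opENorm _ _
    _ = (∫⁻ z, ‖hessEst (box u) p Ft (segPoint x y a) z‖ₑ ^ 2 ∂(law ν p (segPoint x y a)))
          * ‖y - x‖ₑ ^ 2 := lintegral_mul_const _ (hmh.enorm.pow_const 2)
    _ ≤ ENNReal.ofReal (L ^ 2) * ‖y - x‖ₑ ^ 2 := by
        gcongr
        refine ((eLpNorm_le_ofReal_iff (k := 2) two_ne_zero hL0).1
          (hb.eLpNorm_hessEst_le h hu hw)).trans (ENNReal.ofReal_le_ofReal (by gcongr))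
    _ = _ := by
        rw [mul_pow, ENNReal.ofReal_mul (by positivity), ← ofReal_norm,
          ENNReal.ofReal_pow (norm_nonneg _)]

end SegmentLaw

/-- Integration against a random element whose conditional law given a σ-algebra is a kernel
evaluated at a measurable function. -/
lemma lintegral_comp_of_cond_law {Ω S β : Type*} {𝓖 mΩ : MeasurableSpace Ω} [MeasurableSpace S]
    [MeasurableSpace β] {P : Measure Ω} [IsProbabilityMeasure P] (h𝓖 : 𝓖 ≤ mΩ) {W : Ω → S}
    (hW : Measurable[𝓖] W) {b : Ω → β} (hb : Measurable b) {κ : Kernel S β} [IsMarkovKernel κ]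
    (hlaw : ∀ A, MeasurableSet[𝓖] A → ∀ s, MeasurableSet s →
      P (A ∩ b ⁻¹' s) = ∫⁻ ω in A, κ (W ω) s ∂P)
    {h : S × β → ENNReal} (hh : Measurable h) :
    ∫⁻ ω, h (W ω, b ω) ∂P = ∫⁻ ω, ∫⁻ y, h (W ω, y) ∂(κ (W ω)) ∂P := by
  have hW' : Measurable W := hW.mono h𝓖 le_rfl
  have : IsProbabilityMeasure (P.map W) := Measure.isProbabilityMeasure_map hW'.aemeasurable
  -- The hypothesis identifies the joint law on rectangles, and these determine it.
  have hmap : P.map (fun ω => (W ω, b ω)) = (P.map W) ⊗ₘ κ := by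
    have : IsProbabilityMeasure (P.map fun ω => (W ω, b ω)) :=
      Measure.isProbabilityMeasure_map (hW'.prodMk hb).aemeasurable
    refine Measure.ext_prod fun {s t} hs ht => ?_
    rw [Measure.map_apply (hW'.prodMk hb) (hs.prod ht), Measure.compProd_apply_prod hs ht,
      setLIntegral_map hs (κ.measurable_coe ht) hW', ← hlaw _ (hW hs) _ ht]
    rfl
  rw [← lintegral_map hh (hW'.prodMk hb), hmap, Measure.lintegral_compProd hh,
    lintegral_map (hh.lintegral_kernel_prod_right') hW']

/-! ### Error of the gradient estimates along a run -/

section Run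

variable {n : ℕ} {u : Fin n → ℝ} {Z Ω : Type*} [MeasurableSpace Z] {mΩ : MeasurableSpace Ω}
  {ν : Measure Z} {p Ft : Vec n → Z → ℝ} {B G LF Gp Lp L D : ℝ} {P : Measure Ω}
  {C : Set (Vec n)} {T m₀ m : ℕ} {ℱ : Filtration ℕ mΩ} {batch₀ : Ω → Fin m₀ → Z}
  {batch : ℕ → Ω → Fin m → ℝ × Z} {g v x : ℕ → Ω → Vec n}

lemma IsRun.x_mem_box (hrun : IsRun P C (box u) ν p Ft T m₀ m ℱ batch₀ batch g v x)
    (hC : C ⊆ box u) (hT : 1 ≤ T) {t : ℕ} (ht : t ≤ T) (ω : Ω) : x t ω ∈ box u := by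
  have hT0 : (0 : ℝ) < T := by exact_mod_cast hT
  -- The induction needs the sharper bound `(s / T) u i`: each step adds `1 / T` of a point of the
  -- box, so only after `T` steps may the upper face be reached.
  have key : ∀ s ≤ T, ∀ i, 0 ≤ x s ω i ∧ x s ω i ≤ s / T * u i := by
    intro s
    induction s with
    | zero => intro _ i; simp [hrun.x_zero ω]
    | succ s ih =>
      intro hs i
      have h1 := ih (by omega) i
      have h2 := hC (hrun.v_mem s (by omega) ω) i
      rw [hrun.x_succ s (by omega) ω]
      simp only [PiLp.add_apply, PiLp.smul_apply, smul_eq_mul]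
      constructor
      · have := mul_nonneg (by positivity : (0 : ℝ) ≤ 1 / T) h2.1
        linarith [h1.1]
      · have := mul_le_mul_of_nonneg_left h2.2 (by positivity : (0 : ℝ) ≤ 1 / T)
        push_cast
        calc _ ≤ s / T * u i + 1 / T * u i := add_le_add h1.2 this
          _ = _ := by ring
  intro i
  have h1 := key t ht i
  have hu0 : 0 ≤ u i := by
    have := hC (hrun.v_mem 0 hT ω) i
    linarith
  refine ⟨h1.1, h1.2.trans (mul_le_of_le_one_left hu0 ?_)⟩
  rw [div_le_one hT0]
  exact_mod_cast ht

lemma IsRun.x_succ_sub (hrun : IsRun P C (box u) ν p Ft T m₀ m ℱ batch₀ batch g v x) {t : ℕ}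
    (ht : t < T) (ω : Ω) : x (t + 1) ω - x t ω = (1 / (T : ℝ)) • v t ω := by
  rw [hrun.x_succ t ht ω, add_sub_cancel_left]

lemma IsRun.norm_x_succ_sub_le (hrun : IsRun P C (box u) ν p Ft T m₀ m ℱ batch₀ batch g v x)
    (hD : ∀ w ∈ C, ‖w‖ ≤ D) {t : ℕ} (ht : t < T) (ω : Ω) :
    ‖x (t + 1) ω - x t ω‖ ≤ D / T := by
  rw [hrun.x_succ_sub ht, norm_smul, Real.norm_of_nonneg (by positivity), one_div_mul_eq_div]
  gcongr
  exact hD _ (hrun.v_mem t ht ω)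

/-- The next iterate is known one index early, at time `t`. The law of batch `t + 1`, which depends
on both endpoints of the segment, is therefore determined by the past. -/
lemma IsRun.measurable_x_succ (hrun : IsRun P C (box u) ν p Ft T m₀ m ℱ batch₀ batch g v x)
    {t : ℕ} (ht : t < T) (hx : Measurable[ℱ t] (x t)) : Measurable[ℱ t] (x (t + 1)) := by
  have he : x (t + 1) = fun ω => x t ω + (1 / (T : ℝ)) • v t ω := funext (hrun.x_succ t ht)
  rw [he]
  have h1 := (hrun.measurable_v t ht).const_smul (1 / (T : ℝ))
  exact hx.add h1

lemma IsRun.measurable_x (hrun : IsRun P C (box u) ν p Ft T m₀ m ℱ batch₀ batch g v x)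
    {t : ℕ} (ht : t ≤ T) : Measurable[ℱ t] (x t) := by
  induction t with
  | zero =>
    have he : x 0 = fun _ => 0 := funext hrun.x_zero
    rw [he]; exact measurable_const
  | succ t ih =>
    exact (hrun.measurable_x_succ ht (ih (by omega))).mono (ℱ.mono (Nat.le_succ t)) le_rfl

/-- The gradient estimates of a run, with the sampled points projected onto the box. -/
def clampedEst (u : Fin n → ℝ) (p Ft : Vec n → Z → ℝ) (batch : ℕ → Ω → Fin m → ℝ × Z)
    (g x : ℕ → Ω → Vec n) : ℕ → Ω → Vec n
  | 0, ω => g 0 ω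
  | t + 1, ω => clampedEst u p Ft batch g x t ω + (m : ℝ)⁻¹ • ∑ i,
      hessEst (box u) p Ft (clamp u (segPoint (x t ω) (x (t + 1) ω) (batch (t + 1) ω i).1))
        (batch (t + 1) ω i).2 (x (t + 1) ω - x t ω)

/-- The average Hessian estimate over a batch, applied to the step, is jointly measurable. -/
lemma IsModel.measurable_average_hessEst (h : IsModel (box u) ν p Ft) (hu : ∀ i, 0 < u i)
    {Ω' : Type*} {mΩ' : MeasurableSpace Ω'} {y z : Ω' → Vec n} {b : Ω' → Fin m → ℝ × Z}
    (hy : Measurable y) (hz : Measurable z) (hb : Measurable b) :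
    Measurable fun ω => (m : ℝ)⁻¹ • ∑ i, hessEst (box u) p Ft
      (clamp u (segPoint (y ω) (z ω) (b ω i).1)) (b ω i).2 (z ω - y ω) := by
  have hi : ∀ i, Measurable fun ω => hessEst (box u) p Ft
      (clamp u (segPoint (y ω) (z ω) (b ω i).1)) (b ω i).2 (z ω - y ω) := by
    intro i
    have hbi : Measurable fun ω => b ω i := (measurable_pi_apply i).comp hb
    have h1 := (h.measurable_clamped_hessEst hu).comp ((hy.prodMk hz).prodMk hbi)
    exact h1
  have hsum := (Finset.measurable_fun_sum Finset.univ fun i _ => hi i).const_smul (m : ℝ)⁻¹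
  exact hsum

lemma IsModel.measurable_average_gradEst (h : IsModel (box u) ν p Ft) (hu : ∀ i, 0 < u i)
    {Ω' : Type*} {mΩ' : MeasurableSpace Ω'} {b : Ω' → Fin m → Z} (hb : Measurable b) :
    Measurable fun ω => (m : ℝ)⁻¹ • ∑ i, gradEst (box u) p Ft 0 (b ω i) := by
  have hi : ∀ i, Measurable fun ω => gradEst (box u) p Ft 0 (b ω i) := fun i =>
    (h.measurable_gradEst hu (zero_mem_box hu)).comp ((measurable_pi_apply i).comp hb)
  have hsum := (Finset.measurable_fun_sum Finset.univ fun i _ => hi i).const_smul (m : ℝ)⁻¹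
  exact hsum

/-- The model is measurable only for parameters in the box, so `g` need not be measurable where a
sampled position leaves `[0, 1]`. The projected version is, and it agrees with `g` almost surely. -/
lemma IsRun.measurable_clampedEst
    (hrun : IsRun P C (box u) ν p Ft T m₀ m ℱ batch₀ batch g v x)
    (h : IsModel (box u) ν p Ft) (hu : ∀ i, 0 < u i) {t : ℕ} (ht : t < T) :
    Measurable[ℱ t] (clampedEst u p Ft batch g x t) := by
  induction t with
  | zero =>
    have he : clampedEst u p Ft batch g x 0
        = fun ω => (m₀ : ℝ)⁻¹ • ∑ i, gradEst (box u) p Ft 0 (batch₀ ω i) := funext hrun.g_zero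
    rw [he]
    exact h.measurable_average_gradEst hu hrun.measurable_batch₀
  | succ t ih =>
    have hle := ℱ.mono (Nat.le_succ t)
    have hx := (hrun.measurable_x (t := t) (by omega)).mono hle le_rfl
    exact ((ih (by omega)).mono hle le_rfl).add (h.measurable_average_hessEst hu hx
      (hrun.measurable_x (by omega)) (hrun.measurable_batch t ht))

/-- The error of the gradient estimate. -/
def gradError (u : Fin n → ℝ) (ν : Measure Z) (p Ft : Vec n → Z → ℝ)
    (batch : ℕ → Ω → Fin m → ℝ × Z) (g x : ℕ → Ω → Vec n) (t : ℕ) (ω : Ω) : Vec n :=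
  gradMean (box u) ν p Ft (clamp u (x t ω)) - clampedEst u p Ft batch g x t ω

/-- The batch estimate with no inherited error, since `gradMean` at `0` is by definition the mean of
the averaged samples. -/
lemma IsRun.lintegral_gradError_zero_le [IsProbabilityMeasure P]
    (hrun : IsRun P C (box u) ν p Ft T m₀ m ℱ batch₀ batch g v x)
    (h : IsModel (box u) ν p Ft) (hb : MomentBounds (box u) ν p Ft B G LF Gp Lp)
    (hu : ∀ i, 0 < u i) (hm₀ : 1 ≤ m₀) :
    ∫⁻ ω, ‖gradError u ν p Ft batch g x 0 ω‖ₑ ^ 2 ∂P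
      ≤ ENNReal.ofReal ((G + B * Gp) ^ 2 / m₀) := by
  have h0 := zero_mem_box hu
  have hlaw := h.isProbabilityMeasure_law h0
  have hGB : 0 ≤ G + B * Gp :=
    add_nonneg (hb.G_nonneg h hu) (mul_nonneg (hb.B_nonneg h hu) hb.Gp_nonneg)
  have hm := h.measurable_gradEst hu h0
  have h1 := lintegral_enorm_sq_add_sub_average_le (m := m₀) hm₀ hm.aestronglyMeasurable
    ((eLpNorm_le_ofReal_iff (k := 2) two_ne_zero hGB).1 (hb.eLpNorm_gradEst_le h hu h0)) 0
  simp only [zero_add, norm_zero, ne_eq, OfNat.ofNat_ne_zero, not_false_eq_true, zero_pow] at h1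
  refine le_trans (le_of_eq ?_) h1
  have hmeas : Measurable fun b : Fin m₀ → Z => ‖(∫ z, gradEst (box u) p Ft 0 z ∂(law ν p 0))
      - (m₀ : ℝ)⁻¹ • ∑ i, gradEst (box u) p Ft 0 (b i)‖ₑ ^ 2 :=
    (measurable_const.sub (h.measurable_average_gradEst hu measurable_id)).enorm.pow_const 2
  rw [← hrun.law_batch₀, lintegral_map hmeas (hrun.measurable_batch₀.mono (ℱ.le 0) le_rfl)]
  refine lintegral_congr fun ω => ?_
  rw [gradError, hrun.x_zero ω, clamp_of_mem h0, clampedEst, hrun.g_zero ω, gradMean]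

variable [SigmaFinite ν]

/-- The sampled positions lie in `[0, 1]` almost surely, so that the projection onto the box does
not change the gradient estimates. -/
lemma IsRun.ae_clampedEst_eq (hrun : IsRun P C (box u) ν p Ft T m₀ m ℱ batch₀ batch g v x)
    (h : IsModel (box u) ν p Ft) (hu : ∀ i, 0 < u i) (hC : C ⊆ box u) (hT : 1 ≤ T) :
    ∀ᵐ ω ∂P, ∀ t < T, clampedEst u p Ft batch g x t ω = g t ω := by
  have hP := h.isProbabilityMeasure_clampedSegLaw hu
  have hN : MeasurableSet {q : ℝ × Z | q.1 ∉ Icc (0 : ℝ) 1} :=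
    (measurableSet_Icc.preimage measurable_fst).compl
  have hseg : ∀ q, clampedSegLaw u ν p q {q : ℝ × Z | q.1 ∉ Icc (0 : ℝ) 1} = 0 := fun q =>
    withDensity_absolutelyContinuous _ _ (ae_prod_fst_mem_Icc ν)
  have hbatch : ∀ t, t + 1 < T → ∀ i, ∀ᵐ ω ∂P, (batch (t + 1) ω i).1 ∈ Icc (0 : ℝ) 1 := by
    intro t ht i
    have hS : MeasurableSet ((fun b : Fin m → ℝ × Z => b i) ⁻¹' {q | q.1 ∉ Icc (0 : ℝ) 1}) :=
      hN.preimage (measurable_pi_apply i)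
    have h1 := hrun.law_batch t ht univ MeasurableSet.univ _ hS
    rw [univ_inter] at h1
    refine h1.trans ?_
    rw [Measure.restrict_univ]
    refine (lintegral_congr fun ω => ?_).trans lintegral_zero
    rw [segLaw_eq_clampedSegLaw (hrun.x_mem_box hC hT (by omega) ω)
      (hrun.x_mem_box hC hT (by omega) ω)]
    rw [(measurePreserving_eval (fun _ : Fin m =>
      clampedSegLaw u ν p (x t ω, x (t + 1) ω)) i).measure_preimage hN.nullMeasurableSet]
    exact hseg _
  have hall : ∀ᵐ ω ∂P, ∀ t, t + 1 < T → ∀ i, (batch (t + 1) ω i).1 ∈ Icc (0 : ℝ) 1 := by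
    rw [ae_all_iff]; intro t
    by_cases ht : t + 1 < T
    · filter_upwards [ae_all_iff.2 (hbatch t ht)] with ω hω _ using hω
    · exact .of_forall fun ω h' => absurd h' ht
  filter_upwards [hall] with ω hω t
  induction t with
  | zero => intro _; rfl
  | succ t ih =>
    intro ht
    rw [hrun.g_succ t ht ω, ← ih (by omega), clampedEst]
    congr 1
    rw [smul_apply, sum_apply]
    congr 1
    refine Finset.sum_congr rfl fun i _ => ?_
    rw [clamp_of_mem (segPoint_mem (convex_box u) (hrun.x_mem_box hC hT (by omega) ω)
      (hrun.x_mem_box hC hT (by omega) ω) (hω t ht i))]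

lemma MomentBounds.measurable_gradMean_clamp (hb : MomentBounds (box u) ν p Ft B G LF Gp Lp)
    (h : IsModel (box u) ν p Ft) (hu : ∀ i, 0 < u i) :
    Measurable fun y => gradMean (box u) ν p Ft (clamp u y) := by
  have hcont : ContinuousOn (gradMean (box u) ν p Ft) (box u) := by
    refine (LipschitzOnWith.of_dist_le_mul
      (K := ⟨_, hb.smoothness_nonneg h hu⟩) fun y hy x hx => ?_).continuousOn
    rw [dist_eq_norm, dist_eq_norm]
    exact hb.norm_gradMean_sub_le h hu le_rfl hx hy
  exact (hcont.comp_continuous (continuous_clamp u) (clamp_mem hu)).measurable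

lemma IsRun.measurable_gradError
    (hrun : IsRun P C (box u) ν p Ft T m₀ m ℱ batch₀ batch g v x)
    (h : IsModel (box u) ν p Ft) (hb : MomentBounds (box u) ν p Ft B G LF Gp Lp)
    (hu : ∀ i, 0 < u i) {t : ℕ} (ht : t < T) :
    Measurable[ℱ t] (gradError u ν p Ft batch g x t) :=
  ((hb.measurable_gradMean_clamp h hu).comp (hrun.measurable_x ht.le)).sub
    (hrun.measurable_clampedEst h hu ht)

/-- One step of the variance recursion. -/
lemma IsRun.lintegral_gradError_succ_le [IsProbabilityMeasure P]
    (hrun : IsRun P C (box u) ν p Ft T m₀ m ℱ batch₀ batch g v x)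
    (h : IsModel (box u) ν p Ft) (hb : MomentBounds (box u) ν p Ft B G LF Gp Lp)
    (hu : ∀ i, 0 < u i) (hC : C ⊆ box u) (hD : ∀ w ∈ C, ‖w‖ ≤ D)
    (hL : B * Gp ^ 2 + 2 * G * Gp + LF + B * Lp ≤ L) (hT : 1 ≤ T) (hm : 1 ≤ m) {t : ℕ}
    (ht : t + 1 < T) :
    ∫⁻ ω, ‖gradError u ν p Ft batch g x (t + 1) ω‖ₑ ^ 2 ∂P
      ≤ ∫⁻ ω, ‖gradError u ν p Ft batch g x t ω‖ₑ ^ 2 ∂P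
        + ENNReal.ofReal ((L * D / T) ^ 2 / m) := by
  have hP := h.isProbabilityMeasure_clampedSegLaw hu
  have hL0 : 0 ≤ L := (hb.smoothness_nonneg h hu).trans hL
  let κ : Kernel (Vec n × Vec n × Vec n) (Fin m → ℝ × Z) :=
    ⟨fun w => Measure.pi fun _ => clampedSegLaw u ν p (w.1, w.2.1),
      (h.measurable_pi_clampedSegLaw hu m).comp
        (measurable_fst.prodMk (measurable_fst.comp measurable_snd))⟩
  have : IsMarkovKernel κ := ⟨fun w => by
    change IsProbabilityMeasure (Measure.pi fun _ => clampedSegLaw u ν p (w.1, w.2.1))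
    infer_instance⟩
  -- The state known before the batch is drawn: both endpoints of the segment and the current error.
  -- Given it, the new error is the function `Φ` below of the batch, namely the old error plus a
  -- centred average.
  let W : Ω → Vec n × Vec n × Vec n :=
    fun ω => (x t ω, x (t + 1) ω, gradError u ν p Ft batch g x t ω)
  have hx := hrun.measurable_x (t := t) (by omega)
  have hW : Measurable[ℱ t] W := hx.prodMk
    ((hrun.measurable_x_succ (by omega) hx).prodMk
      (hrun.measurable_gradError h hb hu (by omega)))
  have hxm : ∀ ω, x t ω ∈ box u := hrun.x_mem_box hC hT (by omega)
  have hxm' : ∀ ω, x (t + 1) ω ∈ box u := hrun.x_mem_box hC hT (by omega)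
  let Φ : (Vec n × Vec n × Vec n) × (Fin m → ℝ × Z) → Vec n := fun r =>
    r.1.2.2 + (gradMean (box u) ν p Ft (clamp u r.1.2.1) - gradMean (box u) ν p Ft (clamp u r.1.1)
      - (m : ℝ)⁻¹ • ∑ i, hessEst (box u) p Ft (clamp u (segPoint r.1.1 r.1.2.1 (r.2 i).1))
        (r.2 i).2 (r.1.2.1 - r.1.1))
  have hΦ : Measurable Φ := by
    have m1 : Measurable fun r : (Vec n × Vec n × Vec n) × (Fin m → ℝ × Z) => r.1.1 := by fun_prop
    have m2 : Measurable fun r : (Vec n × Vec n × Vec n) × (Fin m → ℝ × Z) => r.1.2.1 := by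
      fun_prop
    have m3 : Measurable fun r : (Vec n × Vec n × Vec n) × (Fin m → ℝ × Z) => r.1.2.2 := by
      fun_prop
    have hg := hb.measurable_gradMean_clamp h hu
    exact m3.add (((hg.comp m2).sub (hg.comp m1)).sub
      (h.measurable_average_hessEst hu m1 m2 measurable_snd))
  have herr : ∀ ω, gradError u ν p Ft batch g x (t + 1) ω = Φ (W ω, batch (t + 1) ω) := by
    intro ω
    simp only [gradError, clampedEst, Φ, W]
    abel
  have hbm : Measurable (batch (t + 1)) := (hrun.measurable_batch t ht).mono (ℱ.le _) le_rfl
  have hlaw : ∀ A, MeasurableSet[ℱ t] A → ∀ s, MeasurableSet s →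
      P (A ∩ batch (t + 1) ⁻¹' s) = ∫⁻ ω in A, κ (W ω) s ∂P := by
    intro A hA s hs
    rw [hrun.law_batch t ht A hA s hs]
    refine lintegral_congr fun ω => ?_
    rw [segLaw_eq_clampedSegLaw (hxm ω) (hxm' ω)]
    rfl
  have key := lintegral_comp_of_cond_law (ℱ.le t) hW hbm hlaw (hΦ.enorm.pow_const 2)
  have hbound : ∀ ω, ∫⁻ b, ‖Φ (W ω, b)‖ₑ ^ 2 ∂(κ (W ω))
      ≤ ‖gradError u ν p Ft batch g x t ω‖ₑ ^ 2 + ENNReal.ofReal ((L * D / T) ^ 2 / m) := by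
    intro ω
    have h1 := lintegral_enorm_sq_add_sub_average_le (m := m) hm
      (h.measurable_clamped_hessEst_left hu (x t ω) (x (t + 1) ω)).aestronglyMeasurable
      (hb.lintegral_clampedSegLaw_le h hu hL (hxm ω) (hxm' ω))
      (gradError u ν p Ft batch g x t ω)
    rw [hb.integral_clampedSegLaw h hu (hxm ω) (hxm' ω), ENNReal.ofReal_add (by positivity)
      (by positivity), ENNReal.ofReal_pow (norm_nonneg _), ofReal_norm] at h1
    have hstep : (L * ‖x (t + 1) ω - x t ω‖) ^ 2 / m ≤ (L * D / T) ^ 2 / m := by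
      have := hrun.norm_x_succ_sub_le hD (t := t) (by omega) ω
      rw [mul_div_assoc]
      gcongr
    refine le_trans (le_of_eq ?_) (h1.trans (add_le_add le_rfl (ENNReal.ofReal_le_ofReal hstep)))
    simp only [Φ, W, κ, clamp_of_mem (hxm ω), clamp_of_mem (hxm' ω)]
    rfl
  have hmeas : Measurable fun ω => ‖gradError u ν p Ft batch g x t ω‖ₑ ^ 2 :=
    (((hrun.measurable_gradError h hb hu (t := t) (by omega)).mono (ℱ.le t) le_rfl).enorm).pow_const 2
  calc _ = ∫⁻ ω, ‖Φ (W ω, batch (t + 1) ω)‖ₑ ^ 2 ∂P := by simp_rw [herr]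
    _ = ∫⁻ ω, ∫⁻ b, ‖Φ (W ω, b)‖ₑ ^ 2 ∂(κ (W ω)) ∂P := key
    _ ≤ ∫⁻ ω, (‖gradError u ν p Ft batch g x t ω‖ₑ ^ 2
          + ENNReal.ofReal ((L * D / T) ^ 2 / m)) ∂P := lintegral_mono hbound
    _ = _ := by rw [lintegral_add_left hmeas]; simp

/-- The mean squared error of the gradient estimates along a run. -/
lemma IsRun.lintegral_gradError_le [IsProbabilityMeasure P]
    (hrun : IsRun P C (box u) ν p Ft T m₀ m ℱ batch₀ batch g v x)
    (h : IsModel (box u) ν p Ft) (hb : MomentBounds (box u) ν p Ft B G LF Gp Lp)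
    (hu : ∀ i, 0 < u i) (hC : C ⊆ box u) (hD : ∀ w ∈ C, ‖w‖ ≤ D)
    (hL : B * Gp ^ 2 + 2 * G * Gp + LF + B * Lp ≤ L) (hT : 1 ≤ T) (hm : T ≤ m) (hm₀ : 1 ≤ m₀)
    (hbatch : (G + B * Gp) ^ 2 * (T : ℝ) ^ 2 ≤ (m₀ : ℝ) * (L * D) ^ 2) {t : ℕ} (ht : t < T) :
    ∫⁻ ω, ‖gradError u ν p Ft batch g x t ω‖ₑ ^ 2 ∂P
      ≤ ENNReal.ofReal ((L * D / T) ^ 2 * (1 + t / T)) := by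
  have hT0 : (0 : ℝ) < T := by exact_mod_cast hT
  have hm₀0 : (0 : ℝ) < m₀ := by exact_mod_cast hm₀
  have hmT : (T : ℝ) ≤ m := by exact_mod_cast hm
  induction t with
  | zero =>
    refine (hrun.lintegral_gradError_zero_le h hb hu hm₀).trans (ENNReal.ofReal_le_ofReal ?_)
    -- The size condition on `m₀` is exactly what makes the initial error at most `(L D / T)²`.
    rw [div_pow, Nat.cast_zero, zero_div, add_zero, mul_one, div_le_div_iff₀ hm₀0 (by positivity)]
    linarith
  | succ t ih =>
    refine (hrun.lintegral_gradError_succ_le h hb hu hC hD hL hT (hT.trans hm) ht).trans ?_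
    refine (add_le_add (ih (by omega)) le_rfl).trans ?_
    rw [← ENNReal.ofReal_add (by positivity) (by positivity)]
    refine ENNReal.ofReal_le_ofReal ?_
    have : (L * D / T) ^ 2 / m ≤ (L * D / T) ^ 2 / T := by gcongr
    calc _ ≤ (L * D / T) ^ 2 * (1 + t / T) + (L * D / T) ^ 2 / T := by linarith
      _ = _ := by push_cast; ring

end Run

/-- Only the initial gap is discounted; since `q ≤ 1`, the discount on the accumulated errors may be
dropped. -/
lemma le_of_contraction_recursion {d e : ℕ → ℝ} {q : ℝ} {T : ℕ} (hq0 : 0 ≤ q) (hq1 : q ≤ 1)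
    (he : ∀ t, 0 ≤ e t) (h : ∀ t < T, d (t + 1) ≤ q * d t + e t) :
    d T ≤ q ^ T * d 0 + ∑ t ∈ Finset.range T, e t := by
  have key : ∀ t ≤ T, d t ≤ q ^ t * d 0 + ∑ s ∈ Finset.range t, e s := by
    intro t
    induction t with
    | zero => simp
    | succ t ih =>
      intro ht
      have hs : 0 ≤ ∑ s ∈ Finset.range t, e s := Finset.sum_nonneg fun _ _ => he _
      calc d (t + 1) ≤ q * d t + e t := h t ht
        _ ≤ q * (q ^ t * d 0 + ∑ s ∈ Finset.range t, e s) + e t := by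
          gcongr; exact ih (by omega)
        _ ≤ q ^ (t + 1) * d 0 + (∑ s ∈ Finset.range t, e s + e t) := by
          have := mul_le_of_le_one_left hs hq1
          rw [pow_succ]
          linarith
        _ = _ := by rw [Finset.sum_range_succ]
  exact key T le_rfl

/-- The numerical inequality behind the confidence bound. -/
lemma one_add_mul_sq_le {T : ℕ} (hT : 1 ≤ T) {δ : ℝ} (hδ : 0 < δ) (hTδ : (T : ℝ) ≤ δ ^ 2) :
    (1 + (1 - 1 / (T : ℝ)) / 2) * δ ^ 2 ≤ T * (δ - (1 - 1 / (T : ℝ)) / 2) ^ 2 := by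
  rcases Nat.eq_or_lt_of_le hT with rfl | hT2
  · norm_num
  have hT2' : (2 : ℝ) ≤ T := by exact_mod_cast hT2
  set r := √(T : ℝ) with hr
  have hr2 : r ^ 2 = T := Real.sq_sqrt (by positivity)
  have hrδ : r ≤ δ := Real.sqrt_le_iff.2 ⟨hδ.le, hTδ⟩
  have hr1 : 1.41 ≤ r := Real.le_sqrt_of_sq_le (by norm_num; linarith)
  have hr0 : 0 < r := by linarith
  rw [← hr2]
  set a := (1 - 1 / r ^ 2) / 2 with ha
  have hinv : 1 / r ^ 2 ≤ 1 := by rw [div_le_one (by positivity), hr2]; linarith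
  have ha0 : 0 ≤ a := by rw [ha]; linarith
  have ha1 : a ≤ 1 / 2 := by
    have : 0 ≤ 1 / r ^ 2 := by positivity
    linarith
  have har : 2 * a * r = r - 1 / r := by rw [ha]; field_simp
  -- Since `2 a r = r - 1 / r` and `a² - a ≥ -1/4`, it suffices that `r² - r + 1/r ≥ 5/4`, a cubic
  -- inequality that holds from `r = 1.41`, just below `√2`. The case `T = 1` has `a = 0` and was
  -- settled separately.
  have hmain : 1 + a ≤ (r - a) ^ 2 := by
    have h1 : 0 ≤ r ^ 2 - r + 1 / r - 5 / 4 := by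
      have h2 : r ^ 2 - r + 1 / r - 5 / 4 = (r ^ 3 - r ^ 2 - 5 / 4 * r + 1) / r := by
        field_simp
        ring
      rw [h2]
      refine div_nonneg ?_ hr0.le
      nlinarith [mul_nonneg (sub_nonneg.2 hr1) (sub_nonneg.2 hr1), mul_nonneg (mul_nonneg
        (sub_nonneg.2 hr1) (sub_nonneg.2 hr1)) hr0.le]
    nlinarith [sq_nonneg (a - 1 / 2)]
  -- As `r ≤ δ`, this reduces the claim to the worst case `δ = r = √T`.
  have hstep : δ * (r - a) ≤ r * (δ - a) := by nlinarith
  have hra : 0 ≤ r - a := by linarith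
  calc (1 + a) * δ ^ 2 ≤ (r - a) ^ 2 * δ ^ 2 := by gcongr
    _ = (δ * (r - a)) ^ 2 := by ring
    _ ≤ (r * (δ - a)) ^ 2 := by gcongr
    _ = _ := by ring

/-- A form of Markov's inequality for a sum of squared norms. -/
lemma one_sub_le_measureReal_of_lintegral_le {Ω : Type*} [MeasurableSpace Ω] {P : Measure Ω}
    [IsProbabilityMeasure P] {Q : Ω → ℝ} (hQ : Measurable Q) {c s η : ℝ} (hη : 0 ≤ η)
    (hint : ∫⁻ ω, ENNReal.ofReal (Q ω) ∂P ≤ ENNReal.ofReal c) (hs : 0 ≤ s) (hc : c ≤ η * s) :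
    1 - η ≤ P.real {ω | Q ω ≤ s} := by
  have hmeas : MeasurableSet {ω | Q ω ≤ s} := measurableSet_le hQ measurable_const
  have hcompl : P {ω | Q ω ≤ s}ᶜ ≤ ENNReal.ofReal η := by
    -- With threshold `0` Markov's inequality gives nothing, but then `c ≤ 0`, so `Q ≤ 0` almost
    -- surely.
    rcases hs.eq_or_lt with rfl | hs0
    · have h0 : ∫⁻ ω, ENNReal.ofReal (Q ω) ∂P = 0 := by
        refine le_antisymm (hint.trans ?_) zero_le
        rw [ENNReal.ofReal_of_nonpos (by simpa using hc)]
      rw [lintegral_eq_zero_iff hQ.ennreal_ofReal] at h0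
      have : P {ω | Q ω ≤ 0}ᶜ = 0 := by
        rw [← mem_ae_iff]
        filter_upwards [h0] with ω hω
        simpa using hω
      rw [this]; exact zero_le
    · have h1 := mul_meas_ge_le_lintegral (μ := P) hQ.ennreal_ofReal (ENNReal.ofReal s)
      have h2 : {ω | Q ω ≤ s}ᶜ ⊆ {ω | ENNReal.ofReal s ≤ ENNReal.ofReal (Q ω)} := by
        intro ω hω
        have : s < Q ω := by simpa using hω
        exact ENNReal.ofReal_le_ofReal this.le
      have hs' : ENNReal.ofReal s ≠ 0 := by simpa using hs0
      refine (measure_mono h2).trans ?_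
      refine (ENNReal.mul_le_mul_iff_right hs' ENNReal.ofReal_ne_top).1 ?_
      rw [← ENNReal.ofReal_mul hs, mul_comm s]
      exact h1.trans (hint.trans (ENNReal.ofReal_le_ofReal hc))
  have h3 := probReal_compl_eq_one_sub (μ := P) hmeas
  have h4 : P.real {ω | Q ω ≤ s}ᶜ ≤ η := ENNReal.toReal_le_of_le_ofReal hη hcompl
  linarith

/-! ### From small average error to the objective value -/

section Run

variable {n : ℕ} {u : Fin n → ℝ} {Z Ω : Type*} [MeasurableSpace Z] {mΩ : MeasurableSpace Ω}
  {ν : Measure Z} [SigmaFinite ν] {p Ft : Vec n → Z → ℝ} {B G LF Gp Lp L D : ℝ} {P : Measure Ω}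
  {C : Set (Vec n)} {T m₀ m : ℕ} {ℱ : Filtration ℕ mΩ} {batch₀ : Ω → Fin m₀ → Z}
  {batch : ℕ → Ω → Fin m → ℝ × Z} {g v x : ℕ → Ω → Vec n}

/-- The deterministic analysis of the Frank–Wolfe iterations with inexact gradients. -/
lemma IsRun.objective_ge (hrun : IsRun P C (box u) ν p Ft T m₀ m ℱ batch₀ batch g v x)
    (h : IsModel (box u) ν p Ft) (hb : MomentBounds (box u) ν p Ft B G LF Gp Lp)
    (hmono : MonotoneObj (box u) (objective ν p Ft))
    (hDR : DRSubmodular (box u) (objective ν p Ft)) (hzero : 0 ≤ objective ν p Ft 0)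
    (hu : ∀ i, 0 < u i) (hC : C ⊆ box u) (hdiam : ∀ y ∈ insert 0 C, ∀ w ∈ insert 0 C, ‖y - w‖ ≤ D)
    (hL : B * Gp ^ 2 + 2 * G * Gp + LF + B * Lp ≤ L) (hT : 1 ≤ T) {xstar : Vec n}
    (hxstar : xstar ∈ C) {ω : Ω} (hω : ∀ t < T, clampedEst u p Ft batch g x t ω = g t ω) :
    (1 - 1 / Real.exp 1) * objective ν p Ft xstar
      - D * (1 / T * ∑ t ∈ Finset.range T, ‖gradError u ν p Ft batch g x t ω‖)
      - L * D ^ 2 / (2 * T) ≤ objective ν p Ft (x T ω) := by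
  have hT0 : (0 : ℝ) < T := by exact_mod_cast hT
  have hT1 : (1 : ℝ) ≤ T := by exact_mod_cast hT
  have hL0 : 0 ≤ L := (hb.smoothness_nonneg h hu).trans hL
  have hD : ∀ w ∈ C, ‖w‖ ≤ D := fun w hw => by
    simpa using hdiam w (mem_insert_of_mem _ hw) 0 (mem_insert _ _)
  have hD0 : 0 ≤ D := (norm_nonneg _).trans (hD xstar hxstar)
  have hsmooth := fun y (hy : y ∈ box u) w (hw : w ∈ box u) =>
    hb.abs_objective_sub_inner_le h hu hL hy hw
  set F := objective ν p Ft
  set ε := fun t => gradError u ν p Ft batch g x t ω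
  have hOPT : 0 ≤ F xstar :=
    hzero.trans (hmono 0 (zero_mem_box hu) xstar (hC hxstar) fun i => (hC hxstar i).1)
  -- Taylor along the step bounds the progress by `⟪gradMean x_t, v_t⟫ / T`. Since `v_t` is optimal
  -- for `g t`, replacing it by `xstar` costs only `⟪ε t, v_t - xstar⟫`, at most `D ‖ε t‖` in
  -- absolute value. The DR inequality bounds `⟪gradMean x_t, xstar⟫` below by the current gap.
  have hrec : ∀ t < T, F xstar - F (x (t + 1) ω) ≤ (1 - 1 / T) * (F xstar - F (x t ω))
      + (1 / T * (D * ‖ε t‖) + L * D ^ 2 / (2 * T ^ 2)) := by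
    intro t ht
    have hxt := hrun.x_mem_box hC hT ht.le ω
    have hxt' := hrun.x_mem_box hC hT (t := t + 1) ht ω
    have h1 := (abs_le.1 (hsmooth _ hxt _ hxt')).1
    rw [hrun.x_succ_sub ht, inner_smul_right, norm_smul, Real.norm_of_nonneg (by positivity)] at h1
    have hv := hrun.v_mem t ht ω
    have h2 : L / 2 * (1 / T * ‖v t ω‖) ^ 2 ≤ L * D ^ 2 / (2 * T ^ 2) :=
      calc L / 2 * (1 / T * ‖v t ω‖) ^ 2 ≤ L / 2 * (1 / T * D) ^ 2 := by
            gcongr; exact hD _ hv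
        _ = _ := by ring
    have hε : gradMean (box u) ν p Ft (x t ω) = g t ω + ε t := by
      simp only [ε, gradError, clamp_of_mem hxt, hω t ht]; abel
    have h3 := hrun.v_max t ht ω xstar hxstar
    have h4 := hDR.sub_le_inner_of_monotone hmono hu hsmooth hxt (hC hxstar)
    have h5 : -(D * ‖ε t‖) ≤ inner ℝ (ε t) (v t ω - xstar) := by
      have := (abs_le.1 (abs_real_inner_le_norm (ε t) (v t ω - xstar))).1
      have h6 := hdiam (v t ω) (mem_insert_of_mem _ hv) xstar (mem_insert_of_mem _ hxstar)
      have h7 := mul_le_mul_of_nonneg_left h6 (norm_nonneg (ε t))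
      linarith
    have h6 : F xstar - F (x t ω) - D * ‖ε t‖
        ≤ inner ℝ (gradMean (box u) ν p Ft (x t ω)) (v t ω) := by
      rw [hε, inner_add_left] at h4 ⊢
      rw [inner_sub_right] at h5
      linarith
    have h7 := mul_le_mul_of_nonneg_left h6 (by positivity : (0 : ℝ) ≤ 1 / T)
    linarith
  have hq0 : 0 ≤ 1 - 1 / (T : ℝ) := by
    rw [sub_nonneg, div_le_one hT0]; exact hT1
  have hsum := le_of_contraction_recursion (d := fun t => F xstar - F (x t ω)) hq0
    (by linarith [(by positivity : (0 : ℝ) ≤ 1 / T)]) (fun t => by positivity) hrec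
  have hexp : (1 - 1 / (T : ℝ)) ^ T ≤ 1 / Real.exp 1 := by
    have := Real.one_sub_div_pow_le_exp_neg (n := T) (t := 1) hT1
    rwa [Real.exp_neg, ← one_div] at this
  have h0 : (1 - 1 / (T : ℝ)) ^ T * (F xstar - F (x 0 ω)) ≤ 1 / Real.exp 1 * F xstar := by
    rw [hrun.x_zero ω]
    calc _ ≤ (1 - 1 / (T : ℝ)) ^ T * F xstar := by gcongr; linarith
      _ ≤ _ := by gcongr
  rw [Finset.sum_add_distrib, ← Finset.mul_sum, ← Finset.mul_sum, Finset.sum_const,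
    Finset.card_range, nsmul_eq_mul] at hsum
  have hconst : (T : ℝ) * (L * D ^ 2 / (2 * T ^ 2)) = L * D ^ 2 / (2 * T) := by field_simp
  rw [hconst] at hsum
  linarith

/-- The average squared error is small with high probability. -/
lemma IsRun.one_sub_le_measureReal_gradError [IsProbabilityMeasure P]
    (hrun : IsRun P C (box u) ν p Ft T m₀ m ℱ batch₀ batch g v x)
    (h : IsModel (box u) ν p Ft) (hb : MomentBounds (box u) ν p Ft B G LF Gp Lp)
    (hu : ∀ i, 0 < u i) (hC : C ⊆ box u) (hD : ∀ w ∈ C, ‖w‖ ≤ D)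
    (hL : B * Gp ^ 2 + 2 * G * Gp + LF + B * Lp ≤ L) (hT : 1 ≤ T) (hm : T ≤ m) (hm₀ : 1 ≤ m₀)
    (hbatch : (G + B * Gp) ^ 2 * (T : ℝ) ^ 2 ≤ (m₀ : ℝ) * (L * D) ^ 2) {δ : ℝ} (hδ : 0 < δ)
    (hTδ : (T : ℝ) ≤ δ ^ 2) :
    1 - T / δ ^ 2 ≤ P.real {ω |
      1 / T * ∑ t ∈ Finset.range T, ‖gradError u ν p Ft batch g x t ω‖ ^ 2
        ≤ (L * D / T * (δ - (1 - 1 / (T : ℝ)) / 2)) ^ 2} := by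
  have hT0 : (0 : ℝ) < T := by exact_mod_cast hT
  have hmeas : ∀ t ∈ Finset.range T, Measurable (gradError u ν p Ft batch g x t) := fun t ht =>
    (hrun.measurable_gradError h hb hu (Finset.mem_range.1 ht)).mono (ℱ.le t) le_rfl
  -- The constant is the average over `t < T` of the bounds `(L D / T)² (1 + t / T)`, as the `t / T`
  -- average to `(1 - 1 / T) / 2`.
  refine one_sub_le_measureReal_of_lintegral_le
    (c := (L * D / T) ^ 2 * (1 + (1 - 1 / (T : ℝ)) / 2)) ?_ (by positivity) ?_ (sq_nonneg _) ?_
  · exact (Finset.measurable_fun_sum _ fun t ht => (hmeas t ht).norm.pow_const 2).const_mul _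
  · have hpt : ∀ ω, ENNReal.ofReal (1 / T * ∑ t ∈ Finset.range T,
        ‖gradError u ν p Ft batch g x t ω‖ ^ 2) = ENNReal.ofReal (1 / T) *
          ∑ t ∈ Finset.range T, ‖gradError u ν p Ft batch g x t ω‖ₑ ^ 2 := by
      intro ω
      rw [ENNReal.ofReal_mul (by positivity), ENNReal.ofReal_sum_of_nonneg fun _ _ => by positivity]
      simp_rw [ENNReal.ofReal_pow (norm_nonneg _), ofReal_norm]
    have hmsq := fun t ht => (hmeas t ht).enorm.pow_const 2
    simp_rw [hpt]
    rw [lintegral_const_mul _ (Finset.measurable_fun_sum _ hmsq), lintegral_finsetSum _ hmsq]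
    have hsum : ∑ t ∈ Finset.range T, ∫⁻ ω, ‖gradError u ν p Ft batch g x t ω‖ₑ ^ 2 ∂P
        ≤ ENNReal.ofReal (∑ t ∈ Finset.range T, (L * D / T) ^ 2 * (1 + t / T)) := by
      rw [ENNReal.ofReal_sum_of_nonneg fun _ _ => by positivity]
      exact Finset.sum_le_sum fun t ht =>
        hrun.lintegral_gradError_le h hb hu hC hD hL hT hm hm₀ hbatch (Finset.mem_range.1 ht)
    refine (mul_le_mul_right hsum _).trans (le_of_eq ?_)
    rw [← ENNReal.ofReal_mul (by positivity)]
    congr 1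
    have hgauss : ∑ t ∈ Finset.range T, (t : ℝ) = T * (T - 1) / 2 := by
      have := Finset.sum_range_id_mul_two T
      have h2 : ((∑ t ∈ Finset.range T, t : ℕ) : ℝ) * 2 = T * (T - 1) := by
        rw [← Nat.cast_ofNat, ← Nat.cast_mul, this, Nat.cast_mul, Nat.cast_sub hT, Nat.cast_one]
      push_cast at h2
      linarith
    rw [← Finset.mul_sum, Finset.sum_add_distrib, ← Finset.sum_div, hgauss]
    simp only [Finset.sum_const, Finset.card_range, nsmul_eq_mul, mul_one]
    field_simp
  · have h1 := one_add_mul_sq_le hT hδ hTδ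
    have h2 : 1 + (1 - 1 / (T : ℝ)) / 2 ≤ T / δ ^ 2 * (δ - (1 - 1 / (T : ℝ)) / 2) ^ 2 := by
      rw [div_mul_eq_mul_div, le_div_iff₀ (by positivity)]
      exact h1
    calc _ ≤ (L * D / T) ^ 2 * (T / δ ^ 2 * (δ - (1 - 1 / (T : ℝ)) / 2) ^ 2) := by gcongr
      _ = _ := by ring

end Run

end SCGPlusPlus

end

theorem theorem5 {n : ℕ} {Z Ω : Type*} [MeasurableSpace Z] [MeasurableSpace Ω]
    -- the domain, the constraint set and the random samples
    (u : Fin n → ℝ) (hu : ∀ i, 0 < u i)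
    (C : Set (SCGPlusPlus.Vec n)) (hC_compact : IsCompact C) (hC_convex : Convex ℝ C)
    (hC_sub : C ⊆ SCGPlusPlus.box u)
    (ν : Measure Z) [SigmaFinite ν] (p Ft : SCGPlusPlus.Vec n → Z → ℝ)
    (hmodel : SCGPlusPlus.IsModel (SCGPlusPlus.box u) ν p Ft)
    -- the objective is monotone and DR-submodular
    (hmono : SCGPlusPlus.MonotoneObj (SCGPlusPlus.box u) (SCGPlusPlus.objective ν p Ft))
    (hDR : SCGPlusPlus.DRSubmodular (SCGPlusPlus.box u) (SCGPlusPlus.objective ν p Ft))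
    -- bounded diameter (the starting point `0` included)
    (D : ℝ) (hdiam : ∀ x ∈ insert 0 C, ∀ y ∈ insert 0 C, ‖x - y‖ ≤ D)
    -- nonnegative value at the origin
    (hzero : 0 ≤ SCGPlusPlus.objective ν p Ft 0)
    -- bounded stochastic function, gradient and Hessian
    (B G LF : ℝ)
    (hB : ∀ x ∈ SCGPlusPlus.box u, ∀ z, |Ft x z| ≤ B)
    (hG : ∀ x ∈ SCGPlusPlus.box u, ∀ z,
      ‖gradientWithin (fun y => Ft y z) (SCGPlusPlus.box u) x‖ ≤ G)
    (hLF : ∀ x ∈ SCGPlusPlus.box u, ∀ z,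
      ‖SCGPlusPlus.hess (SCGPlusPlus.box u) (fun y => Ft y z) x‖ ≤ LF)
    -- moment bounds for the gradient and the Hessian of `log p`
    (Gp Lp : ℝ) (hGp_nonneg : 0 ≤ Gp) (hLp_nonneg : 0 ≤ Lp)
    (hGp : ∀ x ∈ SCGPlusPlus.box u,
      ∫⁻ z, ‖SCGPlusPlus.score (SCGPlusPlus.box u) p x z‖ₑ ^ 4 ∂(SCGPlusPlus.law ν p x)
        ≤ ENNReal.ofReal (Gp ^ 4))
    (hLp : ∀ x ∈ SCGPlusPlus.box u,
      ∫⁻ z, ‖SCGPlusPlus.scoreHess (SCGPlusPlus.box u) p x z‖ₑ ^ 2 ∂(SCGPlusPlus.law ν p x)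
        ≤ ENNReal.ofReal (Lp ^ 2))
    -- Lipschitz Hessians
    (L2F L2p : ℝ)
    (hL2F : ∀ z, ∀ x ∈ SCGPlusPlus.box u, ∀ y ∈ SCGPlusPlus.box u,
      ‖SCGPlusPlus.hess (SCGPlusPlus.box u) (fun w => Ft w z) x
        - SCGPlusPlus.hess (SCGPlusPlus.box u) (fun w => Ft w z) y‖ ≤ L2F * ‖x - y‖)
    (hL2p : ∀ z, ∀ x ∈ SCGPlusPlus.box u, ∀ y ∈ SCGPlusPlus.box u,
      ‖SCGPlusPlus.scoreHess (SCGPlusPlus.box u) p x z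
        - SCGPlusPlus.scoreHess (SCGPlusPlus.box u) p y z‖ ≤ L2p * ‖x - y‖)
    -- the smoothness constant
    (L : ℝ) (hL : B * Gp ^ 2 + 2 * G * Gp + LF + B * Lp ≤ L)
    -- the algorithm: number of iterations, batch sizes and a run
    (T m₀ m : ℕ) (hT : 1 ≤ T) (hm : T ≤ m) (hm₀_pos : 1 ≤ m₀)
    (hm₀ : (G + B * Gp) ^ 2 * (T : ℝ) ^ 2 ≤ (m₀ : ℝ) * (L * D) ^ 2)
    (P : Measure Ω) [IsProbabilityMeasure P] (ℱ : Filtration ℕ ‹MeasurableSpace Ω›)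
    (batch₀ : Ω → Fin m₀ → Z) (batch : ℕ → Ω → Fin m → ℝ × Z)
    (g v x : ℕ → Ω → SCGPlusPlus.Vec n)
    (hrun : SCGPlusPlus.IsRun P C (SCGPlusPlus.box u) ν p Ft T m₀ m ℱ batch₀ batch g v x)
    -- a maximizer of the objective over `C`, and the confidence parameter
    (xstar : SCGPlusPlus.Vec n) (hxstar_mem : xstar ∈ C)
    (hxstar_max : IsMaxOn (SCGPlusPlus.objective ν p Ft) C xstar)
    (δ : ℝ) (hδ : 0 < δ) :
    1 - (T : ℝ) / δ ^ 2 ≤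
        P.real {ω | (1 - 1 / Real.exp 1) * SCGPlusPlus.objective ν p Ft xstar
          - δ * (L * D ^ 2 / (T : ℝ)) - L * D ^ 2 / (2 * (T : ℝ) ^ 2)
            ≤ SCGPlusPlus.objective ν p Ft (x T ω)} ∧
    1 - (T : ℝ) / δ ^ 2 ≤
        P.real {ω | (1 - 1 / Real.exp 1) * SCGPlusPlus.objective ν p Ft xstar
          - (3 / 2 * (L * D ^ 2)) * (δ / (T : ℝ))
            ≤ SCGPlusPlus.objective ν p Ft (x T ω)} := by
  have hb : SCGPlusPlus.MomentBounds (SCGPlusPlus.box u) ν p Ft B G LF Gp Lp :=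
    ⟨hB, hG, hLF, hGp_nonneg, hLp_nonneg, hGp, hLp⟩
  have hT0 : (0 : ℝ) < T := by exact_mod_cast hT
  have hT1 : (1 : ℝ) ≤ T := by exact_mod_cast hT
  have hL0 : 0 ≤ L := (hb.smoothness_nonneg hmodel hu).trans hL
  have hD : ∀ w ∈ C, ‖w‖ ≤ D := fun w hw => by
    simpa using hdiam w (mem_insert_of_mem _ hw) 0 (mem_insert _ _)
  have hD0 : 0 ≤ D := (norm_nonneg _).trans (hD xstar hxstar_mem)
  -- If `δ² < T`, the claimed probability is negative. Otherwise `δ² ≥ T ≥ 1`, so `δ ≥ 1`.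
  rcases lt_or_ge (δ ^ 2) (T : ℝ) with hδT | hTδ
  · have hneg : 1 - (T : ℝ) / δ ^ 2 ≤ 0 := by
      rw [sub_nonpos, one_le_div (by positivity)]
      exact hδT.le
    exact ⟨hneg.trans measureReal_nonneg, hneg.trans measureReal_nonneg⟩
  have hδ1 : 1 ≤ δ := by
    by_contra! hlt
    nlinarith
  set E₁ : Set Ω := {ω | (1 - 1 / Real.exp 1) * SCGPlusPlus.objective ν p Ft xstar
    - δ * (L * D ^ 2 / (T : ℝ)) - L * D ^ 2 / (2 * (T : ℝ) ^ 2)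
      ≤ SCGPlusPlus.objective ν p Ft (x T ω)} with hE₁
  have hfirst : 1 - (T : ℝ) / δ ^ 2 ≤ P.real E₁ := by
    refine (hrun.one_sub_le_measureReal_gradError hmodel hb hu hC_sub hD hL hT hm hm₀_pos hm₀ hδ
      hTδ).trans ?_
    refine ENNReal.toReal_mono (measure_ne_top _ _) (measure_mono_ae ?_)
    filter_upwards [hrun.ae_clampedEst_eq hmodel hu hC_sub hT] with ω hω hQ
    replace hQ : 1 / T * ∑ t ∈ Finset.range T,
        ‖SCGPlusPlus.gradError u ν p Ft batch g x t ω‖ ^ 2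
          ≤ (L * D / T * (δ - (1 - 1 / (T : ℝ)) / 2)) ^ 2 := hQ
    change _ ≤ SCGPlusPlus.objective ν p Ft (x T ω)
    have hge := hrun.objective_ge hmodel hb hmono hDR hzero hu hC_sub hdiam hL hT hxstar_mem hω
    have ha : (1 - 1 / (T : ℝ)) / 2 ≤ δ := by
      have : 0 ≤ 1 / (T : ℝ) := by positivity
      linarith
    have hs : 0 ≤ L * D / T * (δ - (1 - 1 / (T : ℝ)) / 2) :=
      mul_nonneg (by positivity) (sub_nonneg.2 ha)
    -- Cauchy–Schwarz: the average error is controlled by the average squared error, to which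
    -- Markov's inequality was applied.
    have hcs : (1 / T * ∑ t ∈ Finset.range T,
        ‖SCGPlusPlus.gradError u ν p Ft batch g x t ω‖) ^ 2
          ≤ 1 / T * ∑ t ∈ Finset.range T,
            ‖SCGPlusPlus.gradError u ν p Ft batch g x t ω‖ ^ 2 := by
      have := sq_sum_le_card_mul_sum_sq (s := Finset.range T)
        (f := fun t => ‖SCGPlusPlus.gradError u ν p Ft batch g x t ω‖)
      rw [Finset.card_range] at this
      calc _ = (1 / (T : ℝ)) ^ 2 * (∑ t ∈ Finset.range T,
            ‖SCGPlusPlus.gradError u ν p Ft batch g x t ω‖) ^ 2 := mul_pow _ _ _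
        _ ≤ (1 / (T : ℝ)) ^ 2 * (T * ∑ t ∈ Finset.range T,
            ‖SCGPlusPlus.gradError u ν p Ft batch g x t ω‖ ^ 2) := by gcongr
        _ = _ := by field_simp
    have hS := mul_le_mul_of_nonneg_left (abs_le_of_sq_le_sq' (hcs.trans hQ) hs).2 hD0
    -- The subtracted `(1 - 1/T) / 2` in the threshold is chosen for this identity: it absorbs the
    -- Frank–Wolfe loss `L D² / (2 T)`, leaving only `L D² / (2 T²)`.
    have hcomb : D * (L * D / T * (δ - (1 - 1 / (T : ℝ)) / 2)) + L * D ^ 2 / (2 * T)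
        = δ * (L * D ^ 2 / (T : ℝ)) + L * D ^ 2 / (2 * (T : ℝ) ^ 2) := by
      field_simp
      ring
    linarith
  refine ⟨hfirst, hfirst.trans (measureReal_mono fun ω hω => ?_)⟩
  have hω' : (1 - 1 / Real.exp 1) * SCGPlusPlus.objective ν p Ft xstar
    - δ * (L * D ^ 2 / (T : ℝ)) - L * D ^ 2 / (2 * (T : ℝ) ^ 2)
      ≤ SCGPlusPlus.objective ν p Ft (x T ω) := hω
  have hK : 0 ≤ L * D ^ 2 := by positivity
  -- From `δ T ≥ 1`, the second-order term is at most half of `L D² δ / T`, which accounts for the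
  -- factor `3 / 2`.
  have hsmall : L * D ^ 2 / (2 * (T : ℝ) ^ 2) ≤ L * D ^ 2 * δ / (2 * T) := by
    rw [div_le_div_iff₀ (by positivity) (by positivity)]
    have h1 : 1 ≤ δ * T := one_le_mul_of_one_le_of_one_le hδ1 hT1
    have := mul_le_mul_of_nonneg_left h1 (by positivity : 0 ≤ L * D ^ 2 * (2 * T))
    linarith
  have hsplit : 3 / 2 * (L * D ^ 2) * (δ / (T : ℝ))
      = δ * (L * D ^ 2 / (T : ℝ)) + L * D ^ 2 * δ / (2 * T) := by
    field_simp
    ring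
  change _ ≤ SCGPlusPlus.objective ν p Ft (x T ω)
  linarith
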